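/- For each integer $N\ge 1$ let $G_1,G_2,\dots$ be i.i.d. $N\times N$ complex Ginibre matrices, that is, all entries of all the matrices are independent with law $\mathscr N_{\mathbb C}(0,\tfrac1N)$. Here, for $\sigma^2>0$, $\mathscr N_{\mathbb C}(0,\sigma^2)$ denotes the law of $X+iY$, where $X,Y$ are independent real centered Gaussian variables of variance $\sigma^2/2$ each. Let $w=G_{i_1}G_{i_2}\cdots G_{i_m}$ be any non-empty $*$-free word, that is, a finite word of length $m\ge 1$ in the letters $G_1,G_2,\dots$ (the adjoints $G_i^*$ are not used), let $G_w=G_{i_1}G_{i_2}\cdots G_{i_m}$ be the corresponding random matrix product, and let the coperiod $\mathrm{cop}(w)$ be the largest integer $d$ such that $w=u^d$ (the concatenation of $d$ copies of $u$) for some word $u$. Then for every integer $k\ge 1$, $$\left(\mathrm{Tr}(G_w),\mathrm{Tr}(G_w^2),\dots,\mathrm{Tr}(G_w^k)\right)\xrightarrow[N\to\infty]{d}(Z_1,Z_2,\dots,Z_k),$$ where $Z_1,\dots,Z_k$ are independent and $Z_j$ is $\mathscr N_{\mathbb C}(0,\,j\cdot\mathrm{cop}(w))$-distributed. -/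

import Mathlib

open MeasureTheory ProbabilityTheory Filter
open scoped NNReal

/-- The complex Gaussian law `𝒩_ℂ(0, v)`: the law of `X + iY` with `X`, `Y` independent real
centered Gaussian variables, each of variance `v / 2`. -/
noncomputable def complexGaussian (v : ℝ≥0) : Measure ℂ :=
  ((gaussianReal 0 (v / 2)).prod (gaussianReal 0 (v / 2))).map
    (fun p : ℝ × ℝ => (p.1 : ℂ) + (p.2 : ℂ) * Complex.I)

/-- `G 0, G 1, G 2, …` are i.i.d. `N × N` complex Ginibre matrices on the probability space
`(Ω, P)`: all the entries of all the matrices are jointly independent, each with law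
`𝒩_ℂ(0, 1/N)`. -/
structure IsIIDGinibre {Ω : Type*} [MeasurableSpace Ω] (P : Measure Ω) (N : ℕ)
    (G : ℕ → Ω → Matrix (Fin N) (Fin N) ℂ) : Prop where
  hasLaw_entry : ∀ (r : ℕ) (a b : Fin N),
    HasLaw (fun ω => G r ω a b) (complexGaussian (1 / (N : ℝ≥0))) P
  iIndepFun_entry :
    iIndepFun (fun (p : ℕ × Fin N × Fin N) (ω : Ω) => G p.1 ω p.2.1 p.2.2) P

/-- The product `G_w = G_{i₁} G_{i₂} ⋯ G_{i_m}` for the `*`-free word `w = [i₁, …, i_m]`. -/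
def wordProd {n R : Type*} [Fintype n] [DecidableEq n] [Semiring R]
    (G : ℕ → Matrix n n R) (w : List ℕ) : Matrix n n R :=
  (w.map G).prod

/-- The `k`-th power `u^k` of a word `u`, i.e. the concatenation of `k` copies of `u`. -/
def wordPow {α : Type*} (u : List α) (k : ℕ) : List α :=
  (List.replicate k u).flatten

/-- The coperiod of a (non-empty) word `w`: the largest `k` such that `w = u^k` for some word
`u`. The maximum exists by `isGreatest_coperiod`. -/
noncomputable def coperiod {α : Type*} (w : List α) : ℕ :=
  sSup {k : ℕ | ∃ u : List α, w = wordPow u k}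

theorem isGreatest_coperiod {α : Type*} {w : List α} (hw : w ≠ []) :
    IsGreatest {k : ℕ | ∃ u : List α, w = wordPow u k} (coperiod w) := by
  have hb : BddAbove {k : ℕ | ∃ u : List α, w = wordPow u k} := by
    refine ⟨w.length, ?_⟩
    rintro k ⟨u, hu⟩
    have hu0 : u.length ≠ 0 := by
      intro h
      have h' := List.length_eq_zero_iff.mp h
      subst h'
      apply hw
      rw [hu]
      simp [wordPow]
    rw [hu]
    simp only [wordPow, List.length_flatten, List.map_replicate, List.sum_replicate, smul_eq_mul]
    exact Nat.le_mul_of_pos_right k (Nat.pos_of_ne_zero hu0)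
  exact ⟨Nat.sSup_mem ⟨1, w, by simp [wordPow]⟩ hb, fun k hk => le_csSup hb hk⟩

/-! By Lévy's continuity theorem it suffices to find the limit of the characteristic function `φ s =
E exp(isY)`, at `s = 1`, for each real combination `Y = ∑ Re (c_j Tr G_{w^j})`. Differentiating `φ`
produces `E[Tr(G_{w^j}) exp(isY)]`, and Gaussian integration by parts is applied to the first letter
of `w^j = aA`. A `*`-free word contains no adjoint letter, so the derivative falls only on the
exponential, and there only on the conjugate traces. Each occurrence of `a` in some `w^l`
contributes a normalized trace of `A B*`, where `aB` is the rotation of `w^l` starting at that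
occurrence (`integral_trace_mul_cexp`).

These normalized traces concentrate at `1` if `A = B` and at `0` otherwise
(`tendsto_integral_norm_normTrace_sub`). This is a second moment computation: by the Schwinger–Dyson
recursion `traceMoment_cons`, joint moments of normalized traces factorize in the limit into values
of `wordLimit`, computed for `A B*` in `wordLimit_plainWord_append_starWord`.

What remains is to count the rotations of `w^l` equal to `w^j`: by length there are none unless `l =
j`, and then there are `j * cop(w)` (`sum_splits_wordPow`). The first fact gives independence, the
second the variance. Hence `φ' s ≈ -(s κ / 2) φ s` with `κ = ∑ |c_j|² j cop(w)`, and an integrating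
factor gives `φ 1 → exp(-κ/4)` (`norm_mul_cexp_sub_one_le`, `tendsto_traceCharFun`), the value for
the independent Gaussian limit. -/

set_option linter.unusedSectionVars false

/-! ### Combinatorics of words: rotations, powers, coperiod, occurrences of a letter. -/

section Words

variable {β : Type*}

theorem wordPow_zero (u : List β) : wordPow u 0 = [] := rfl

theorem wordPow_succ (u : List β) (k : ℕ) : wordPow u (k + 1) = u ++ wordPow u k := rfl

theorem length_wordPow (u : List β) (k : ℕ) : (wordPow u k).length = k * u.length := by
  simp [wordPow]

theorem wordPow_rotate_one (u : List β) (k : ℕ) :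
    wordPow (u.rotate 1) k = (wordPow u k).rotate 1 := by
  cases u with
  | nil => simp [wordPow]
  | cons a l =>
    have key : ∀ k : ℕ, a :: wordPow (l ++ [a]) k = wordPow (a :: l) k ++ [a] := by
      intro k
      induction k with
      | zero => simp [wordPow_zero]
      | succ k ih => simp [wordPow_succ, ih]
    cases k with
    | zero => simp [wordPow_zero]
    | succ k =>
      rw [wordPow_succ, wordPow_succ]
      simp [key]

theorem iterate_rotate_one (u : List β) (q : ℕ) :
    (fun v : List β => v.rotate 1)^[q] u = u.rotate q := by
  induction q with
  | zero => simp
  | succ q ih => rw [Function.iterate_succ_apply', ih, List.rotate_rotate]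

theorem wordPow_rotate (u : List β) (k q : ℕ) :
    wordPow (u.rotate q) k = (wordPow u k).rotate q := by
  induction q with
  | zero => simp
  | succ q ih => rw [← List.rotate_rotate, wordPow_rotate_one, ih, List.rotate_rotate]

/-- Rotation commutes with powers, and a positive power determines its base among words of the same
length, as its prefix. -/
theorem wordPow_rotate_eq_self_iff (u : List β) {k : ℕ} (hk : 0 < k) (q : ℕ) :
    (wordPow u k).rotate q = wordPow u k ↔ u.rotate q = u := by
  rw [← wordPow_rotate]
  refine ⟨fun h => ?_, fun h => by rw [h]⟩
  obtain ⟨k, rfl⟩ := Nat.exists_eq_succ_of_ne_zero hk.ne'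
  rw [Nat.succ_eq_add_one, wordPow_succ, wordPow_succ] at h
  exact (List.append_inj h (by simp)).1

/-- When the words commute, `t` is a prefix of `d`; cancelling it leaves a shorter word that still
commutes with `t`. -/
theorem eq_wordPow_of_append_comm {t : List β} (e : ℕ) :
    ∀ d : List β, d.length = e * t.length → t ++ d = d ++ t → d = wordPow t e := by
  induction e with
  | zero =>
    intro d hd _
    simpa [wordPow_zero] using hd
  | succ e ih =>
    intro d hd h
    have hpre : t <+: d := by
      refine List.prefix_of_prefix_length_le (List.prefix_append t d) (h ▸ List.prefix_append d t) ?_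
      rw [hd]
      exact Nat.le_mul_of_pos_left _ (Nat.succ_pos e)
    obtain ⟨d', rfl⟩ := hpre
    rw [wordPow_succ, ← ih d']
    · simp only [List.length_append] at hd
      rw [Nat.add_mul] at hd
      omega
    · simpa using h

theorem eq_wordPow_take_of_rotate {w : List β} {g e : ℕ} (hlen : w.length = e * g)
    (he : 0 < e) (h : w.rotate g = w) : w = wordPow (w.take g) e := by
  obtain ⟨e, rfl⟩ := Nat.exists_eq_succ_of_ne_zero he.ne'
  have hg : g ≤ w.length := by rw [hlen]; exact Nat.le_mul_of_pos_left _ he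
  have ht : (w.take g).length = g := by simp [hg]
  rw [List.rotate_eq_drop_append_take hg] at h
  have hd : w.drop g = wordPow (w.take g) e := by
    apply eq_wordPow_of_append_comm
    · rw [ht, List.length_drop, hlen, Nat.succ_eq_add_one, Nat.add_mul]
      omega
    · rw [List.take_append_drop, h]
  rw [Nat.succ_eq_add_one, wordPow_succ, ← hd, List.take_append_drop]

/-- The period `p` is the length of the base `u` in the maximal decomposition `w = u^cop(w)`. A
rotational period not divisible by `p` would yield a smaller period dividing `p`, hence a larger
exponent. -/
theorem exists_rotate_eq_self_iff_dvd {w : List β} (hw : w ≠ []) :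
    ∃ p : ℕ, 0 < p ∧ w.length = coperiod w * p ∧ ∀ q, w.rotate q = w ↔ p ∣ q := by
  obtain ⟨⟨u, hu⟩, hmax⟩ := isGreatest_coperiod hw
  have hlen : w.length = coperiod w * u.length := by
    conv_lhs => rw [hu]
    exact length_wordPow _ _
  have hm : 0 < w.length := List.length_pos_iff.2 hw
  have hp : 0 < u.length := Nat.pos_of_ne_zero fun h => by rw [h] at hlen; omega
  have hc : 0 < coperiod w := Nat.pos_of_ne_zero fun h => by
    rw [h] at hlen; omega
  have hrot : w.rotate u.length = w := by
    have h1 := (wordPow_rotate_eq_self_iff u hc u.length).2 (List.rotate_length u)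
    rwa [← hu] at h1
  refine ⟨u.length, hp, hlen, fun q => ⟨fun hq => ?_, ?_⟩⟩
  -- Periods of a point under iteration of the one-step rotation are closed under gcd.
  · have hg : w.rotate (Nat.gcd q u.length) = w := by
      rw [← iterate_rotate_one] at hq hrot ⊢
      exact Function.IsPeriodicPt.gcd hq hrot
    obtain ⟨e, he⟩ := Nat.gcd_dvd_right q u.length
    set g := Nat.gcd q u.length with hgdef
    have he0 : 0 < e := Nat.pos_of_ne_zero fun h => by
      rw [h] at he; omega
    have hle := hmax ⟨w.take g, eq_wordPow_take_of_rotate (e := coperiod w * e)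
      (by rw [hlen, he]; ring) (Nat.mul_pos hc he0) hg⟩
    have he1 : e = 1 := by
      have : coperiod w * e ≤ coperiod w * 1 := by simpa using hle
      have := Nat.le_of_mul_le_mul_left this hc
      omega
    rw [he, he1, mul_one]
    exact Nat.gcd_dvd_left _ _
  · rintro ⟨c, rfl⟩
    rw [← iterate_rotate_one] at hrot ⊢
    exact Function.IsPeriodicPt.mul_const (f := fun v : List β => v.rotate 1) hrot c

theorem card_rotate_wordPow_eq_self [DecidableEq β] {w : List β} (hw : w ≠ []) {k : ℕ}
    (hk : 0 < k) :
    ((Finset.range (wordPow w k).length).filter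
      (fun q => (wordPow w k).rotate q = wordPow w k)).card = k * coperiod w := by
  obtain ⟨p, hp, hlen, hiff⟩ := exists_rotate_eq_self_iff_dvd hw
  simp_rw [wordPow_rotate_eq_self_iff w hk, hiff]
  rw [length_wordPow, hlen, ← mul_assoc]
  have : ((Finset.range (k * coperiod w * p)).filter (fun q => p ∣ q)) =
      (Finset.range (k * coperiod w)).image (fun i => p * i) := by
    ext q
    simp only [Finset.mem_filter, Finset.mem_range, Finset.mem_image]
    constructor
    · rintro ⟨h1, i, rfl⟩
      exact ⟨i, by rw [mul_comm] at h1; exact Nat.lt_of_mul_lt_mul_right h1, rfl⟩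
    · rintro ⟨i, hi, rfl⟩
      exact ⟨by rw [mul_comm]; exact Nat.mul_lt_mul_of_pos_right hi hp, i, rfl⟩
  rw [this, Finset.card_image_of_injective _ (fun a b h => Nat.eq_of_mul_eq_mul_left hp h),
    Finset.card_range]

/-- The list of all `(W₁, W₂)` with `W = W₁ ++ l :: W₂`. -/
def splits [DecidableEq β] (l : β) : List β → List (List β × List β)
  | [] => []
  | h :: t => (if h = l then [([], t)] else []) ++ (splits l t).map (fun p => (h :: p.1, p.2))

variable [DecidableEq β]

theorem eq_append_of_mem_splits {l : β} {W : List β} {p : List β × List β}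
    (hp : p ∈ splits l W) : W = p.1 ++ l :: p.2 := by
  induction W generalizing p with
  | nil => simp [splits] at hp
  | cons h t ih =>
    simp only [splits, List.mem_append, List.mem_map] at hp
    rcases hp with hp | ⟨q, hq, rfl⟩
    · split_ifs at hp with hh
      · simp only [List.mem_singleton] at hp
        subst hp hh
        rfl
      · simp at hp
    · simp [← ih hq]

theorem length_of_mem_splits {l : β} {W : List β} {p : List β × List β}
    (hp : p ∈ splits l W) : p.1.length + p.2.length + 1 = W.length := by
  rw [eq_append_of_mem_splits hp]
  simp
  omega

theorem splits_eq_nil {l : β} {W : List β} (h : l ∉ W) : splits l W = [] := by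
  rw [List.eq_nil_iff_forall_not_mem]
  intro p hp
  apply h
  rw [eq_append_of_mem_splits hp]
  simp

theorem splits_append (l : β) (X Y : List β) :
    splits l (X ++ Y) = (splits l X).map (fun p => (p.1, p.2 ++ Y)) ++
      (splits l Y).map (fun p => (X ++ p.1, p.2)) := by
  induction X with
  | nil => simp [splits]
  | cons h t ih =>
    simp only [List.cons_append, splits, ih]
    split_ifs <;> simp [Function.comp_def]

theorem sum_splits_reverse {R : Type*} [AddCommMonoid R] (l : β) (W : List β)
    (f : List β × List β → R) :
    ((splits l W.reverse).map f).sum =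
      ((splits l W).map (fun p => f (p.2.reverse, p.1.reverse))).sum := by
  induction W generalizing f with
  | nil => simp [splits]
  | cons h t ih =>
    simp only [List.reverse_cons, splits_append, splits, List.map_append, List.map_map,
      List.sum_append]
    have := ih (fun p => f (p.1, p.2 ++ [h]))
    simp only [Function.comp_def] at this ⊢
    rw [this, add_comm]
    split_ifs <;> simp

theorem sum_splits_eq_sum_range {R : Type*} [AddCommMonoid R] (l : β) (W : List β)
    (f : List β × List β → R) :
    ((splits l W).map f).sum =
      ∑ q ∈ Finset.range W.length,
        if W[q]? = some l then f (W.take q, W.drop (q + 1)) else 0 := by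
  induction W generalizing f with
  | nil => simp [splits]
  | cons h t ih =>
    simp only [splits, List.map_append, List.map_map, List.sum_append, List.length_cons]
    rw [Finset.sum_range_succ', add_comm]
    have := ih (fun p => f (h :: p.1, p.2))
    simp only [Function.comp_def] at this ⊢
    rw [this]
    congr 1
    split_ifs with h1 h2 h2 <;> simp_all

theorem map_splits_of_injective {γ : Type*} [DecidableEq γ] {f : β → γ}
    (hf : Function.Injective f) (l : β) (W : List β) :
    splits (f l) (W.map f) = (splits l W).map (fun p => (p.1.map f, p.2.map f)) := by
  induction W with
  | nil => simp [splits]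
  | cons h t ih =>
    simp only [List.map_cons, splits, ih, hf.eq_iff]
    split_ifs <;> simp [Function.comp_def]

/-- Cutting `v` at an occurrence of `a` and reading cyclically from there is a rotation of `v`
starting with `a`. -/
theorem sum_splits_rotation {R : Type*} [AddCommMonoidWithOne R] (a : β) (A v : List β) :
    ((splits a v).map (fun p => if A = p.2 ++ p.1 then (1 : R) else 0)).sum =
      ((Finset.range v.length).filter (fun q => v.rotate q = a :: A)).card := by
  rw [sum_splits_eq_sum_range, Finset.card_filter, Nat.cast_sum]
  refine Finset.sum_congr rfl fun q hq => ?_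
  have hq' : q < v.length := by simpa using hq
  rw [List.rotate_eq_drop_append_take hq'.le, List.drop_eq_getElem_cons hq',
    List.getElem?_eq_getElem hq']
  simp only [List.cons_append, List.cons.injEq, Option.some.injEq]
  by_cases h1 : v[q] = a <;> by_cases h2 : A = v.drop (q + 1) ++ v.take q <;>
    simp [h1, h2, eq_comm]

/-- Rotation preserves length, so different powers of `w` never match; for equal powers the count is
that of the rotations fixing `w^l`. This is the covariance matrix of the limit. -/
theorem sum_splits_wordPow {R : Type*} [AddCommMonoidWithOne R] {w : List β} (hw : w ≠ [])
    {j l : ℕ} (hl : 0 < l) {a : β} {A : List β} (hA : wordPow w j = a :: A) :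
    ((splits a (wordPow w l)).map (fun p => if A = p.2 ++ p.1 then (1 : R) else 0)).sum =
      if j = l then ((l * coperiod w : ℕ) : R) else 0 := by
  rw [sum_splits_rotation, ← hA]
  split_ifs with h
  · rw [h, card_rotate_wordPow_eq_self hw hl]
  · rw [Finset.filter_false_of_mem, Finset.card_empty, Nat.cast_zero]
    intro q _ hq
    have h1 := congrArg List.length hq
    rw [List.length_rotate, length_wordPow, length_wordPow] at h1
    exact h (Nat.eq_of_mul_eq_mul_right (List.length_pos_iff.2 hw) h1).symm

end Words

/-! ### Functions of temperate growth: a class closed under differentiation and integrable against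
Gaussian measures. -/

section TemperateGrowth

variable {E F : Type*} [NormedAddCommGroup E] [NormedSpace ℝ E]
  [NormedAddCommGroup F] [NormedSpace ℝ F]

theorem Function.HasTemperateGrowth.fderiv {f : E → F} (hf : f.HasTemperateGrowth) :
    (_root_.fderiv ℝ f).HasTemperateGrowth := by
  refine ⟨hf.1.fderiv_right (m := ((⊤ : ℕ∞) : WithTop ℕ∞)) (by simp), fun n => ?_⟩
  obtain ⟨k, C, h⟩ := hf.2 (n + 1)
  exact ⟨k, C, fun x => by rw [norm_iteratedFDeriv_fderiv]; exact h x⟩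

theorem Function.HasTemperateGrowth.fderiv_apply {f : E → F} (hf : f.HasTemperateGrowth) (v : E) :
    (fun x => _root_.fderiv ℝ f x v).HasTemperateGrowth :=
  (ContinuousLinearMap.apply ℝ F v).hasTemperateGrowth.comp hf.fderiv

theorem Function.HasTemperateGrowth.differentiable {f : E → F} (hf : f.HasTemperateGrowth) :
    Differentiable ℝ f :=
  hf.1.differentiable (by simp)

/-- A Gaussian measure has moments of all orders, which dominate the polynomial bound. -/
theorem Function.HasTemperateGrowth.integrable [MeasurableSpace E] [BorelSpace E]
    [CompleteSpace E] [SecondCountableTopology E]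
    {f : E → F} (hf : f.HasTemperateGrowth) (μ : Measure E) [IsGaussian μ] :
    Integrable f μ := by
  obtain ⟨k, C, h⟩ := hf.2 0
  have hpow : Integrable (fun x : E => (1 + ‖x‖) ^ k) μ := by
    have h1 : MemLp (fun x : E => 1 + ‖x‖) (k : ENNReal) μ :=
      (memLp_const (1 : ℝ)).add (IsGaussian.memLp_id μ k (by simp)).norm
    refine (h1.integrable_norm_pow' ).congr (Eventually.of_forall fun x => ?_)
    simp only [Real.norm_eq_abs]
    rw [abs_of_nonneg (by positivity)]
  refine (hpow.const_mul C).mono' hf.1.continuous.aestronglyMeasurable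
    (Eventually.of_forall fun x => ?_)
  simpa using h x

theorem hasTemperateGrowth_cexp_mul_I (s : ℝ) :
    (fun y : ℝ => Complex.exp (s * y * Complex.I)).HasTemperateGrowth := by
  have hcd : ContDiff ℝ ((⊤ : ℕ∞) : WithTop ℕ∞) (fun y : ℝ => Complex.exp (s * y * Complex.I)) := by
    have : ContDiff ℝ ((⊤ : ℕ∞) : WithTop ℕ∞) (fun y : ℝ => (s * y * Complex.I : ℂ)) :=
      (contDiff_const.mul Complex.ofRealCLM.contDiff).mul contDiff_const
    exact this.cexp
  refine ⟨hcd, fun n => ⟨0, |s| ^ n, fun y => ?_⟩⟩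
  have hit : ∀ n : ℕ, iteratedDeriv n (fun y : ℝ => Complex.exp (s * y * Complex.I)) =
      fun y : ℝ => (s * Complex.I) ^ n * Complex.exp (s * y * Complex.I) := by
    intro n
    induction n with
    | zero => simp
    | succ n ih =>
      rw [iteratedDeriv_succ, ih]
      funext y
      have h1 : HasDerivAt (fun y : ℝ => (s * y * Complex.I : ℂ)) (s * 1 * Complex.I) y :=
        ((Complex.ofRealCLM.hasDerivAt (x := y)).const_mul (s : ℂ)).mul_const Complex.I
      have h2 := (h1.cexp.const_mul ((s * Complex.I) ^ n)).deriv
      rw [h2]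
      ring
  rw [norm_iteratedFDeriv_eq_norm_iteratedDeriv, hit]
  have : ‖Complex.exp (s * y * Complex.I)‖ = 1 := by
    rw [← Complex.ofReal_mul, Complex.norm_exp_ofReal_mul_I]
  simp [this]

end TemperateGrowth

/-! ### Gaussian integration by parts, from one real variable to families of complex ones. -/

section Stein

/-- The density `ρ` satisfies `ρ' = -(p / v) ρ`, so this is ordinary integration by parts; for `v =
0` the measure is a Dirac mass at `0` and both sides vanish. -/
theorem integral_mul_gaussianReal {h : ℝ → ℂ} (hh : h.HasTemperateGrowth) (v : ℝ≥0) :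
    ∫ p, (p : ℂ) * h p ∂(gaussianReal 0 v) = v * ∫ p, fderiv ℝ h p 1 ∂(gaussianReal 0 v) := by
  by_cases hv : v = 0
  · subst hv
    simp
  have hid : (fun p : ℝ => (p : ℂ) * h p).HasTemperateGrowth :=
    Function.Complex.hasTemperateGrowth_ofReal.mul hh
  have hint : ∀ f : ℝ → ℂ, f.HasTemperateGrowth →
      Integrable (fun p => f p * (gaussianPDFReal 0 v p : ℂ)) := by
    intro f hf
    have h1 := hf.integrable (gaussianReal 0 v)
    rw [gaussianReal_of_var_ne_zero _ hv, integrable_withDensity_iff_integrable_smul'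
      (measurable_gaussianPDF 0 v) (by simp [gaussianPDF])] at h1
    refine h1.congr (Eventually.of_forall fun p => ?_)
    simp [toReal_gaussianPDF, mul_comm]
  have hderiv : ∀ p : ℝ, HasDerivAt (fun p => (gaussianPDFReal 0 v p : ℂ))
      (-(p / v) * gaussianPDFReal 0 v p : ℂ) p := by
    intro p
    have h1 : HasDerivAt (gaussianPDFReal 0 v) (-(p / v) * gaussianPDFReal 0 v p) p := by
      rw [gaussianPDFReal_def]
      have h2 : HasDerivAt (fun x : ℝ => -(x - 0) ^ 2 / (2 * v)) (-(p / v)) p := by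
        have h3 := (((hasDerivAt_id p).sub_const (0 : ℝ)).pow 2).neg.div_const (2 * (v : ℝ))
        refine h3.congr_deriv ?_
        have : (v : ℝ) ≠ 0 := by exact_mod_cast hv
        simp
        field_simp
      refine (h2.exp.const_mul _).congr_deriv ?_
      ring
    have h4 := h1.ofReal_comp
    exact_mod_cast h4
  have hv' : (v : ℂ) ≠ 0 := by exact_mod_cast hv
  have key := integral_mul_deriv_eq_deriv_mul_of_integrable (u := h) (u' := fun p => fderiv ℝ h p 1)
    (v := fun p => (gaussianPDFReal 0 v p : ℂ)) (v' := fun p => (-(p / v) * gaussianPDFReal 0 v p : ℂ))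
    (fun p _ => (hh.differentiable p).hasFDerivAt.hasDerivAt) (fun p _ => hderiv p)
    (by
      refine ((hint _ hid).const_mul (-(1 / v : ℂ))).congr (Eventually.of_forall fun p => ?_)
      simp only [Pi.mul_apply]
      ring)
    (hint _ (hh.fderiv_apply 1)) (hint _ hh)
  rw [integral_gaussianReal_eq_integral_smul hv, integral_gaussianReal_eq_integral_smul hv]
  have h5 : ∫ p, (gaussianPDFReal 0 v p) • ((p : ℂ) * h p) =
      -v * ∫ p, h p * (-(p / v) * gaussianPDFReal 0 v p : ℂ) := by
    rw [← integral_const_mul]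
    congr 1
    funext p
    rw [Complex.real_smul]
    field_simp
  rw [h5, key]
  simp only [Complex.real_smul, neg_mul, mul_neg, neg_neg]
  simp_rw [mul_comm (fderiv ℝ h _ 1)]

/-- The continuous linear map `(p, q) ↦ p + q i`. -/
noncomputable def complexOfProd : ℝ × ℝ →L[ℝ] ℂ :=
  Complex.ofRealCLM.comp (ContinuousLinearMap.fst ℝ ℝ ℝ) +
    (ContinuousLinearMap.mul ℝ ℂ).flip Complex.I ∘L
      (Complex.ofRealCLM.comp (ContinuousLinearMap.snd ℝ ℝ ℝ))

theorem complexOfProd_apply (p : ℝ × ℝ) :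
    complexOfProd p = (p.1 : ℂ) + (p.2 : ℂ) * Complex.I := by
  simp [complexOfProd, mul_comm]

theorem complexGaussian_eq_map (v : ℝ≥0) :
    complexGaussian v =
      ((gaussianReal 0 (v / 2)).prod (gaussianReal 0 (v / 2))).map complexOfProd := by
  unfold complexGaussian
  congr 1

instance isGaussian_complexGaussian (v : ℝ≥0) : IsGaussian (complexGaussian v) := by
  rw [complexGaussian_eq_map]
  infer_instance

theorem integral_re_mul_complexGaussian {g : ℂ → ℂ} (hg : g.HasTemperateGrowth) (v : ℝ≥0) :
    ∫ z, (z.re : ℂ) * g z ∂(complexGaussian v) =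
      (v / 2 : ℂ) * ∫ z, fderiv ℝ g z 1 ∂(complexGaussian v) := by
  have hre : (fun z : ℂ => (z.re : ℂ) * g z).HasTemperateGrowth :=
    (Function.Complex.hasTemperateGrowth_ofReal.comp Complex.reCLM.hasTemperateGrowth).mul hg
  have hc : ∀ f : ℂ → ℂ, f.HasTemperateGrowth → ∫ z, f z ∂(complexGaussian v) =
      ∫ q, ∫ p, f (complexOfProd (p, q)) ∂(gaussianReal 0 (v / 2)) ∂(gaussianReal 0 (v / 2)) := by
    intro f hf
    rw [complexGaussian_eq_map, integral_map (by fun_prop) hf.1.continuous.aestronglyMeasurable,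
      integral_prod_symm]
    exact (hf.comp complexOfProd.hasTemperateGrowth).integrable _
  rw [hc _ hre, hc _ (hg.fderiv_apply 1), ← integral_const_mul]
  congr 1
  funext q
  have hcomp : (fun p : ℝ => g (complexOfProd (p, q))).HasTemperateGrowth := by
    refine hg.comp (f := fun p : ℝ => complexOfProd (p, q)) ?_
    have : (fun p : ℝ => complexOfProd (p, q)) =
        fun p : ℝ => Complex.ofRealCLM p + complexOfProd (0, q) := by
      funext p
      simp [complexOfProd_apply]
    rw [this]
    fun_prop
  have h1 := integral_mul_gaussianReal hcomp (v / 2)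
  have h2 : ∀ p : ℝ, fderiv ℝ (fun p : ℝ => g (complexOfProd (p, q))) p 1 =
      fderiv ℝ g (complexOfProd (p, q)) 1 := by
    intro p
    have h3 : HasFDerivAt (fun p : ℝ => complexOfProd (p, q))
        (complexOfProd ∘L ContinuousLinearMap.inl ℝ ℝ ℝ) p :=
      complexOfProd.hasFDerivAt.comp p (hasFDerivAt_prodMk_left p q)
    have h4 := ((hg.differentiable (complexOfProd (p, q))).hasFDerivAt.comp p h3).fderiv
    simp only [Function.comp_def] at h4
    rw [h4]
    simp [complexOfProd_apply]
  simp_rw [h2] at h1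
  convert h1 using 1
  · simp [complexOfProd_apply]
  · simp

theorem integral_im_mul_complexGaussian {g : ℂ → ℂ} (hg : g.HasTemperateGrowth) (v : ℝ≥0) :
    ∫ z, (z.im : ℂ) * g z ∂(complexGaussian v) =
      (v / 2 : ℂ) * ∫ z, fderiv ℝ g z Complex.I ∂(complexGaussian v) := by
  have hre : (fun z : ℂ => (z.im : ℂ) * g z).HasTemperateGrowth :=
    (Function.Complex.hasTemperateGrowth_ofReal.comp Complex.imCLM.hasTemperateGrowth).mul hg
  have hc : ∀ f : ℂ → ℂ, f.HasTemperateGrowth → ∫ z, f z ∂(complexGaussian v) =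
      ∫ p, ∫ q, f (complexOfProd (p, q)) ∂(gaussianReal 0 (v / 2)) ∂(gaussianReal 0 (v / 2)) := by
    intro f hf
    rw [complexGaussian_eq_map, integral_map (by fun_prop) hf.1.continuous.aestronglyMeasurable,
      integral_prod]
    exact (hf.comp complexOfProd.hasTemperateGrowth).integrable _
  rw [hc _ hre, hc _ (hg.fderiv_apply Complex.I), ← integral_const_mul]
  congr 1
  funext p
  have hcomp : (fun q : ℝ => g (complexOfProd (p, q))).HasTemperateGrowth := by
    refine hg.comp (f := fun q : ℝ => complexOfProd (p, q)) ?_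
    have : (fun q : ℝ => complexOfProd (p, q)) =
        fun q : ℝ => (complexOfProd ∘L ContinuousLinearMap.inr ℝ ℝ ℝ) q
          + complexOfProd (p, 0) := by
      funext q
      simp [complexOfProd_apply, add_comm]
    rw [this]
    fun_prop
  have h1 := integral_mul_gaussianReal hcomp (v / 2)
  have h2 : ∀ q : ℝ, fderiv ℝ (fun q : ℝ => g (complexOfProd (p, q))) q 1 =
      fderiv ℝ g (complexOfProd (p, q)) Complex.I := by
    intro q
    have h3 : HasFDerivAt (fun q : ℝ => complexOfProd (p, q))
        (complexOfProd ∘L ContinuousLinearMap.inr ℝ ℝ ℝ) q :=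
      complexOfProd.hasFDerivAt.comp q (hasFDerivAt_prodMk_right p q)
    have h4 := ((hg.differentiable (complexOfProd (p, q))).hasFDerivAt.comp q h3).fderiv
    simp only [Function.comp_def] at h4
    rw [h4]
    simp [complexOfProd_apply]
  simp_rw [h2] at h1
  convert h1 using 1
  · simp [complexOfProd_apply]
  · simp

variable {ι : Type*} [Fintype ι] [DecidableEq ι]

/-- Resampling one coordinate independently does not change a product law. This lets a one-variable
identity be applied in a single coordinate of a family. -/
theorem measurePreserving_update {X : ι → Type*} [∀ i, MeasurableSpace (X i)]
    (μ : ∀ i, Measure (X i)) [∀ i, IsProbabilityMeasure (μ i)] (i : ι) :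
    MeasurePreserving (fun p : (∀ j, X j) × X i => Function.update p.1 i p.2)
      ((Measure.pi μ).prod (μ i)) (Measure.pi μ) := by
  have hm : Measurable (fun p : (∀ j, X j) × X i => Function.update p.1 i p.2) := by
    rw [measurable_pi_iff]
    intro j
    by_cases h : j = i
    · subst h
      simpa using measurable_snd
    · simp only [Function.update_of_ne h]
      fun_prop
  refine ⟨hm, ?_⟩
  symm
  refine Measure.pi_eq fun s hs => ?_
  rw [Measure.map_apply hm (MeasurableSet.univ_pi hs)]
  have : (fun p : (∀ j, X j) × X i => Function.update p.1 i p.2) ⁻¹' (Set.univ.pi s) =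
      (Set.univ.pi (Function.update s i Set.univ)) ×ˢ (s i) := by
    ext p
    simp only [Set.mem_preimage, Set.mem_univ_pi, Set.mem_prod]
    constructor
    · intro h
      refine ⟨fun j => ?_, by simpa using h i⟩
      by_cases hj : j = i
      · subst hj; simp
      · simpa [Function.update_of_ne hj] using h j
    · rintro ⟨h1, h2⟩ j
      by_cases hj : j = i
      · subst hj; simpa using h2
      · simpa [Function.update_of_ne hj] using h1 j
  rw [this, Measure.prod_prod, Measure.pi_pi,
    ← Finset.mul_prod_erase Finset.univ (fun j => μ j (s j)) (Finset.mem_univ i),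
    ← Finset.mul_prod_erase Finset.univ _ (Finset.mem_univ i), mul_comm (μ i (s i))]
  simp only [Function.update_self, measure_univ, one_mul]
  congr 1
  refine Finset.prod_congr rfl fun j hj => ?_
  rw [Function.update_of_ne (Finset.ne_of_mem_erase hj)]

/-- The law of a family of i.i.d. complex Gaussian variables of variance `v`. -/
noncomputable abbrev gaussianPi (ι : Type*) [Fintype ι] (v : ℝ≥0) : Measure (ι → ℂ) :=
  Measure.pi (fun _ : ι => complexGaussian v)

instance isGaussian_gaussianPi (v : ℝ≥0) : IsGaussian (gaussianPi ι v) := by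
  have h1 : iIndepFun (fun (i : ι) (x : ι → ℂ) => x i) (gaussianPi ι v) :=
    iIndepFun_pi (X := fun _ z => z) (fun _ => aemeasurable_id)
  have h2 : ∀ i : ι, HasGaussianLaw (fun x : ι → ℂ => x i) (gaussianPi ι v) := by
    intro i
    refine ⟨?_⟩
    rw [(measurePreserving_eval (fun _ : ι => complexGaussian v) i).map_eq]
    infer_instance
  have h3 := (iIndepFun.hasGaussianLaw h2 h1).isGaussian_map
  rwa [show (fun (x : ι → ℂ) (i : ι) => x i) = id from rfl, Measure.map_id] at h3

theorem integral_gaussianPi_eq_update {f : (ι → ℂ) → ℂ} (hf : f.HasTemperateGrowth) (v : ℝ≥0)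
    (i : ι) :
    ∫ x, f x ∂(gaussianPi ι v) =
      ∫ x, ∫ z, f (Function.update x i z) ∂(complexGaussian v) ∂(gaussianPi ι v) := by
  have hmp : MeasurePreserving (fun p : (ι → ℂ) × ℂ => Function.update p.1 i p.2)
      ((gaussianPi ι v).prod (complexGaussian v)) (gaussianPi ι v) :=
    measurePreserving_update (fun _ : ι => complexGaussian v) i
  have hint := hmp.integrable_comp_of_integrable (hf.integrable (gaussianPi ι v))
  conv_lhs => rw [← hmp.map_eq]
  rw [integral_map hmp.aemeasurable hf.1.continuous.aestronglyMeasurable, integral_prod]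
  exact hint

theorem fderiv_comp_update {f : (ι → ℂ) → ℂ} (hf : f.HasTemperateGrowth) (x : ι → ℂ) (i : ι)
    (z u : ℂ) :
    fderiv ℝ (fun z => f (Function.update x i z)) z u =
      fderiv ℝ f (Function.update x i z) (Pi.single i u) := by
  have h1 : HasFDerivAt (fun z : ℂ => Function.update x i z)
      (ContinuousLinearMap.single ℝ (fun _ : ι => ℂ) i) z := by
    have := hasFDerivAt_update (𝕜 := ℝ) x (i := i) z
    refine this.congr_fderiv ?_
    ext u j
    by_cases h : j = i
    · subst h; simp
    · simp [h]
  have h2 := ((hf.differentiable (Function.update x i z)).hasFDerivAt.comp z h1).fderiv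
  simp only [Function.comp_def] at h2
  rw [h2]
  simp

theorem Function.HasTemperateGrowth.comp_update {f : (ι → ℂ) → ℂ} (hf : f.HasTemperateGrowth)
    (x : ι → ℂ) (i : ι) : (fun z => f (Function.update x i z)).HasTemperateGrowth := by
  have h1 : (fun z : ℂ => Function.update x i z) =
      fun z : ℂ => ContinuousLinearMap.single ℝ (fun _ : ι => ℂ) i z + Function.update x i 0 := by
    funext z j
    by_cases h : j = i
    · subst h; simp
    · simp [h]
  refine hf.comp (f := fun z : ℂ => Function.update x i z) ?_
  rw [h1]
  fun_prop

theorem hasTemperateGrowth_re (i : ι) :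
    (fun x : ι → ℂ => ((x i).re : ℂ)).HasTemperateGrowth :=
  (Complex.ofRealCLM ∘L Complex.reCLM ∘L
    ContinuousLinearMap.proj (R := ℝ) (φ := fun _ : ι => ℂ) i).hasTemperateGrowth

theorem hasTemperateGrowth_im (i : ι) :
    (fun x : ι → ℂ => ((x i).im : ℂ)).HasTemperateGrowth :=
  (Complex.ofRealCLM ∘L Complex.imCLM ∘L
    ContinuousLinearMap.proj (R := ℝ) (φ := fun _ : ι => ℂ) i).hasTemperateGrowth

theorem integral_re_mul_gaussianPi {f : (ι → ℂ) → ℂ} (hf : f.HasTemperateGrowth) (v : ℝ≥0)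
    (i : ι) :
    ∫ x, ((x i).re : ℂ) * f x ∂(gaussianPi ι v) =
      (v / 2 : ℂ) * ∫ x, fderiv ℝ f x (Pi.single i 1) ∂(gaussianPi ι v) := by
  rw [integral_gaussianPi_eq_update ((hasTemperateGrowth_re i).fun_mul hf) v i,
    integral_gaussianPi_eq_update (hf.fderiv_apply _) v i, ← integral_const_mul]
  congr 1
  funext x
  have h := integral_re_mul_complexGaussian (hf.comp_update x i) v
  simp_rw [fderiv_comp_update hf] at h
  simpa using h

theorem integral_im_mul_gaussianPi {f : (ι → ℂ) → ℂ} (hf : f.HasTemperateGrowth) (v : ℝ≥0)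
    (i : ι) :
    ∫ x, ((x i).im : ℂ) * f x ∂(gaussianPi ι v) =
      (v / 2 : ℂ) * ∫ x, fderiv ℝ f x (Pi.single i Complex.I) ∂(gaussianPi ι v) := by
  rw [integral_gaussianPi_eq_update ((hasTemperateGrowth_im i).fun_mul hf) v i,
    integral_gaussianPi_eq_update (hf.fderiv_apply _) v i, ← integral_const_mul]
  congr 1
  funext x
  have h := integral_im_mul_complexGaussian (hf.comp_update x i) v
  simp_rw [fderiv_comp_update hf] at h
  simpa using h

/-- The Wirtinger derivatives: `∂/∂(x̄ᵢ)` for `s = false` and `∂/∂xᵢ` for `s = true`. -/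
noncomputable def wirtinger (s : Bool) (i : ι) (f : (ι → ℂ) → ℂ) (x : ι → ℂ) : ℂ :=
  (1 / 2) * (fderiv ℝ f x (Pi.single i 1) +
    (if s then -Complex.I else Complex.I) * fderiv ℝ f x (Pi.single i Complex.I))

/-- The coordinate `xᵢ` for `s = false` and its conjugate for `s = true`. -/
noncomputable def coordStar (s : Bool) (i : ι) (x : ι → ℂ) : ℂ :=
  if s then starRingEnd ℂ (x i) else x i

theorem coordStar_eq (s : Bool) (i : ι) (x : ι → ℂ) :
    coordStar s i x = (x i).re + (if s then -Complex.I else Complex.I) * (x i).im := by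
  cases s
  · simp [coordStar, mul_comm Complex.I, Complex.re_add_im]
  · apply Complex.ext <;> simp [coordStar]

theorem hasTemperateGrowth_coordStar (s : Bool) (i : ι) :
    (coordStar s i).HasTemperateGrowth := by
  rw [funext (coordStar_eq s i)]
  exact (hasTemperateGrowth_re i).add
    ((Function.HasTemperateGrowth.const _).mul (hasTemperateGrowth_im i))

/-- Gaussian integration by parts. -/
theorem integral_coordStar_mul {f : (ι → ℂ) → ℂ} (hf : f.HasTemperateGrowth) (v : ℝ≥0)
    (s : Bool) (i : ι) :
    ∫ x, coordStar s i x * f x ∂(gaussianPi ι v) =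
      v * ∫ x, wirtinger s i f x ∂(gaussianPi ι v) := by
  have h1 := ((hasTemperateGrowth_re i).fun_mul hf).integrable (gaussianPi ι v)
  have h2 := ((hasTemperateGrowth_im i).fun_mul hf).integrable (gaussianPi ι v)
  have h3 := (hf.fderiv_apply (Pi.single i 1)).integrable (gaussianPi ι v)
  have h4 := (hf.fderiv_apply (Pi.single i Complex.I)).integrable (gaussianPi ι v)
  simp only [wirtinger, coordStar_eq, add_mul, mul_assoc]
  rw [integral_const_mul, integral_add h1 (h2.const_mul _), integral_const_mul,
    integral_add h3 (h4.const_mul _), integral_const_mul, integral_re_mul_gaussianPi hf,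
    integral_im_mul_gaussianPi hf]
  ring

theorem hasTemperateGrowth_wirtinger {f : (ι → ℂ) → ℂ} (hf : f.HasTemperateGrowth) (s : Bool)
    (i : ι) : (wirtinger s i f).HasTemperateGrowth :=
  (Function.HasTemperateGrowth.const _).mul ((hf.fderiv_apply _).add
    ((Function.HasTemperateGrowth.const _).mul (hf.fderiv_apply _)))

theorem wirtinger_const (s : Bool) (i : ι) (c : ℂ) (x : ι → ℂ) :
    wirtinger s i (fun _ => c) x = 0 := by
  simp [wirtinger]

theorem wirtinger_mul {f g : (ι → ℂ) → ℂ} (hf : f.HasTemperateGrowth)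
    (hg : g.HasTemperateGrowth) (s : Bool) (i : ι) (x : ι → ℂ) :
    wirtinger s i (fun x => f x * g x) x = wirtinger s i f x * g x + f x * wirtinger s i g x := by
  have h := fderiv_fun_mul (hf.differentiable x) (hg.differentiable x)
  simp only [wirtinger, h, add_apply, smul_apply,
    smul_eq_mul]
  ring

theorem wirtinger_sum {κ : Type*} (S : Finset κ) {f : κ → (ι → ℂ) → ℂ}
    (hf : ∀ k, (f k).HasTemperateGrowth) (s : Bool) (i : ι) (x : ι → ℂ) :
    wirtinger s i (fun x => ∑ k ∈ S, f k x) x = ∑ k ∈ S, wirtinger s i (f k) x := by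
  have h := fderiv_fun_sum (u := S) (A := f) (fun k _ => (hf k).differentiable x)
  simp only [wirtinger, h, sum_apply, Finset.mul_sum,
    ← Finset.sum_add_distrib]

/-- A coordinate contracts only with its own conjugate, reflecting `E z² = 0` for a centered complex
Gaussian. -/
theorem wirtinger_coordStar (s s' : Bool) (i j : ι) (x : ι → ℂ) :
    wirtinger s i (coordStar s' j) x = if i = j ∧ s' = !s then 1 else 0 := by
  have hL : coordStar s' j = ((if s' then (Complex.conjCLE : ℂ →L[ℝ] ℂ) else
      ContinuousLinearMap.id ℝ ℂ) ∘L
        ContinuousLinearMap.proj (R := ℝ) (φ := fun _ : ι => ℂ) j) := by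
    funext x
    cases s' <;> simp [coordStar]
  rw [hL]
  simp only [wirtinger, ContinuousLinearMap.fderiv]
  by_cases h : i = j
  · subst h
    cases s <;> cases s' <;> norm_num
  · have h' : j ≠ i := fun h' => h h'.symm
    cases s' <;> simp [h, h']

theorem wirtinger_cexp {Y : (ι → ℂ) → ℝ} (hY : (fun x => (Y x : ℂ)).HasTemperateGrowth) (t : ℝ)
    (s : Bool) (i : ι) (x : ι → ℂ) :
    wirtinger s i (fun x => Complex.exp (t * Y x * Complex.I)) x =
      Complex.exp (t * Y x * Complex.I) * (t * Complex.I * wirtinger s i (fun x => (Y x : ℂ)) x) := by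
  have h1 : HasFDerivAt (fun x => Complex.exp (t * Y x * Complex.I))
      ((Complex.exp (t * Y x * Complex.I)) • ((t * Complex.I : ℂ) •
        fderiv ℝ (fun x => (Y x : ℂ)) x)) x := by
    have h2 := ((hY.differentiable x).hasFDerivAt.const_mul (t * Complex.I : ℂ)).cexp
    refine (h2.congr_fderiv ?_).congr_of_eventuallyEq (Eventually.of_forall fun y => ?_)
    · rw [show (t * Y x * Complex.I : ℂ) = t * Complex.I * Y x by ring]
    · simp only [show (t * Y y * Complex.I : ℂ) = t * Complex.I * Y y by ring]
  simp only [wirtinger, h1.fderiv, smul_apply, smul_eq_mul]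
  ring

theorem hasTemperateGrowth_cexp {E : Type*} [NormedAddCommGroup E] [NormedSpace ℝ E]
    {Y : E → ℝ} (hY : Y.HasTemperateGrowth) (t : ℝ) :
    (fun x => Complex.exp (t * Y x * Complex.I)).HasTemperateGrowth :=
  (hasTemperateGrowth_cexp_mul_I t).comp hY

end Stein

/-! ### Temperate growth and integration of finite list sums and products. -/

section TemperateGrowth

variable {E : Type*} [NormedAddCommGroup E] [NormedSpace ℝ E]

theorem Function.HasTemperateGrowth.list_sum_map {κ : Type*} {f : κ → E → ℂ}
    (hf : ∀ k, (f k).HasTemperateGrowth) (L : List κ) :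
    (fun x => (L.map (fun k => f k x)).sum).HasTemperateGrowth := by
  induction L with
  | nil => simp
  | cons h t ih => simpa using (hf h).fun_add ih

theorem Function.HasTemperateGrowth.list_prod_map {κ : Type*} {f : κ → E → ℂ}
    (hf : ∀ k, (f k).HasTemperateGrowth) (L : List κ) :
    (fun x => (L.map (fun k => f k x)).prod).HasTemperateGrowth := by
  induction L with
  | nil => simp
  | cons h t ih => simpa using (hf h).fun_mul ih

theorem integral_list_sum_map {X κ : Type*} [MeasurableSpace X] {μ : Measure X} {f : κ → X → ℂ}
    (hf : ∀ k, Integrable (f k) μ) (L : List κ) :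
    Integrable (fun x => (L.map (fun k => f k x)).sum) μ ∧
    ∫ x, (L.map (fun k => f k x)).sum ∂μ = (L.map (fun k => ∫ x, f k x ∂μ)).sum := by
  induction L with
  | nil => simp
  | cons h t ih =>
    simp only [List.map_cons, List.sum_cons]
    exact ⟨(hf h).add ih.1, by rw [integral_add (hf h) ih.1, ih.2]⟩

end TemperateGrowth

/-! ### Traces of `*`-words in the matrices and the Schwinger–Dyson equation. -/

section MatrixWords

variable {α n : Type*} [Fintype α] [DecidableEq α] [Fintype n] [DecidableEq n]

/-- The matrix of a letter `(r, s)`: the matrix of the `r`-th block of coordinates for `s = false`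
and its adjoint for `s = true`. -/
noncomputable def letterMat (x : α × n × n → ℂ) (l : α × Bool) : Matrix n n ℂ :=
  Matrix.of fun a b => coordStar l.2 (l.1, if l.2 then (b, a) else (a, b)) x

/-- The value of a `*`-word. -/
noncomputable def wordEval (x : α × n × n → ℂ) (W : List (α × Bool)) : Matrix n n ℂ :=
  (W.map (letterMat x)).prod

/-- The adjoint letter. -/
def letterBar (l : α × Bool) : α × Bool := (l.1, !l.2)

/-- The derivative with respect to the `(b, a)` entry of the adjoint letter. -/
noncomputable def letterDeriv (l : α × Bool) (a b : n) (f : (α × n × n → ℂ) → ℂ)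
    (x : α × n × n → ℂ) : ℂ :=
  wirtinger l.2 (l.1, if l.2 then (b, a) else (a, b)) f x

theorem wordEval_nil (x : α × n × n → ℂ) : wordEval x [] = 1 := rfl

theorem wordEval_cons (x : α × n × n → ℂ) (l : α × Bool) (W : List (α × Bool)) :
    wordEval x (l :: W) = letterMat x l * wordEval x W := by
  simp [wordEval]

theorem wordEval_append (x : α × n × n → ℂ) (V W : List (α × Bool)) :
    wordEval x (V ++ W) = wordEval x V * wordEval x W := by
  simp [wordEval]

theorem hasTemperateGrowth_letterMat (l : α × Bool) (a b : n) :
    (fun x : α × n × n → ℂ => letterMat x l a b).HasTemperateGrowth :=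
  hasTemperateGrowth_coordStar _ _

theorem hasTemperateGrowth_wordEval (W : List (α × Bool)) (a b : n) :
    (fun x : α × n × n → ℂ => wordEval x W a b).HasTemperateGrowth := by
  induction W generalizing a b with
  | nil => simp [wordEval_nil]
  | cons h t ih =>
    simp only [wordEval_cons, Matrix.mul_apply]
    exact Function.HasTemperateGrowth.sum fun e _ =>
      (hasTemperateGrowth_letterMat h a e).fun_mul (ih e b)

theorem hasTemperateGrowth_trace (W : List (α × Bool)) :
    (fun x : α × n × n → ℂ => (wordEval x W).trace).HasTemperateGrowth :=
  Function.HasTemperateGrowth.sum fun a _ => hasTemperateGrowth_wordEval W a a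

theorem letterDeriv_mul {f g : (α × n × n → ℂ) → ℂ} (hf : f.HasTemperateGrowth)
    (hg : g.HasTemperateGrowth) (l : α × Bool) (a b : n) (x : α × n × n → ℂ) :
    letterDeriv l a b (fun x => f x * g x) x =
      letterDeriv l a b f x * g x + f x * letterDeriv l a b g x :=
  wirtinger_mul hf hg _ _ x

theorem letterDeriv_const_mul {f : (α × n × n → ℂ) → ℂ} (hf : f.HasTemperateGrowth) (c : ℂ)
    (l : α × Bool) (a b : n) (x : α × n × n → ℂ) :
    letterDeriv l a b (fun x => c * f x) x = c * letterDeriv l a b f x := by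
  rw [letterDeriv_mul (Function.HasTemperateGrowth.const c) hf]
  simp [letterDeriv, wirtinger_const]

theorem letterDeriv_sum {κ : Type*} (S : Finset κ) {f : κ → (α × n × n → ℂ) → ℂ}
    (hf : ∀ k, (f k).HasTemperateGrowth) (l : α × Bool) (a b : n) (x : α × n × n → ℂ) :
    letterDeriv l a b (fun x => ∑ k ∈ S, f k x) x = ∑ k ∈ S, letterDeriv l a b (f k) x :=
  wirtinger_sum S hf _ _ x

theorem hasTemperateGrowth_letterDeriv {f : (α × n × n → ℂ) → ℂ} (hf : f.HasTemperateGrowth)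
    (l : α × Bool) (a b : n) : (letterDeriv l a b f).HasTemperateGrowth :=
  hasTemperateGrowth_wirtinger hf _ _

/-- The index swap for adjoint letters, built into both `letterMat` and `letterDeriv`, makes the
contraction the same matrix unit for either kind of letter. -/
theorem letterDeriv_letterMat (l l' : α × Bool) (a b c d : n) (x : α × n × n → ℂ) :
    letterDeriv l a b (fun x => letterMat x l' c d) x =
      if l' = letterBar l then (if c = b then 1 else 0) * (if d = a then 1 else 0) else 0 := by
  obtain ⟨r, s⟩ := l
  obtain ⟨r', s'⟩ := l'
  have := wirtinger_coordStar s s' (r, if s then (b, a) else (a, b))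
    (r', if s' then (d, c) else (c, d)) x
  simp only [letterDeriv, letterMat, Matrix.of_apply, letterBar]
  rw [this]
  by_cases h1 : r = r' <;> by_cases h2 : c = b <;> by_cases h3 : d = a <;> cases s <;> cases s' <;>
    simp [h1, h2, h3, eq_comm] <;> simp_all [eq_comm]

/-- Leibniz rule: each occurrence of the adjoint letter is replaced by a matrix unit, which cuts the
word in two. -/
theorem letterDeriv_wordEval (l : α × Bool) (a b c d : n) (W : List (α × Bool))
    (x : α × n × n → ℂ) :
    letterDeriv l a b (fun x => wordEval x W c d) x =
      ((splits (letterBar l) W).map (fun p => wordEval x p.1 c b * wordEval x p.2 a d)).sum := by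
  induction W generalizing c d with
  | nil =>
    simp only [splits, wordEval_nil, List.map_nil, List.sum_nil]
    exact wirtinger_const _ _ _ _
  | cons h t ih =>
    simp only [wordEval_cons, Matrix.mul_apply]
    rw [letterDeriv_sum _ (fun e => (hasTemperateGrowth_letterMat h c e).fun_mul
      (hasTemperateGrowth_wordEval t e d))]
    simp_rw [letterDeriv_mul (hasTemperateGrowth_letterMat h c _)
      (hasTemperateGrowth_wordEval t _ d), ih, letterDeriv_letterMat]
    rw [Finset.sum_add_distrib]
    simp only [splits, List.map_append, List.sum_append, List.map_map]
    congr 1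
    · by_cases hh : h = letterBar l
      · simp [hh, wordEval_nil, Matrix.one_apply]
      · simp [hh]
    · simp only [Function.comp_def, wordEval_cons, Matrix.mul_apply]
      generalize splits (letterBar l) t = L
      induction L with
      | nil => simp
      | cons p L ihL =>
        simp only [List.map_cons, List.sum_cons, mul_add, Finset.sum_add_distrib, ihL]
        congr 1
        rw [Finset.sum_mul]
        exact Finset.sum_congr rfl fun e _ => (mul_assoc _ _ _).symm

/-- Under a trace the two pieces left by the cut are glued back in cyclic order. -/
theorem letterDeriv_trace (l : α × Bool) (a b : n) (W : List (α × Bool)) (x : α × n × n → ℂ) :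
    letterDeriv l a b (fun x => (wordEval x W).trace) x =
      ((splits (letterBar l) W).map (fun p => wordEval x (p.2 ++ p.1) a b)).sum := by
  simp only [Matrix.trace, Matrix.diag_apply]
  rw [letterDeriv_sum _ (fun c => hasTemperateGrowth_wordEval W c c)]
  simp_rw [letterDeriv_wordEval]
  generalize splits (letterBar l) W = L
  induction L with
  | nil => simp
  | cons p L ih =>
    simp only [List.map_cons, List.sum_cons, Finset.sum_add_distrib, ih]
    congr 1
    rw [wordEval_append, Matrix.mul_apply]
    exact Finset.sum_congr rfl fun e _ => mul_comm _ _

theorem sum_wordEval_mul_wordEval (x : α × n × n → ℂ) (V W : List (α × Bool)) :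
    ∑ a, ∑ b, wordEval x W b a * wordEval x V a b = (wordEval x (W ++ V)).trace := by
  rw [Finset.sum_comm, wordEval_append]
  simp [Matrix.trace, Matrix.mul_apply]

theorem sum_letterDeriv_wordEval (l : α × Bool) (W : List (α × Bool)) (x : α × n × n → ℂ) :
    ∑ a, ∑ b, letterDeriv l a b (fun x => wordEval x W b a) x =
      ((splits (letterBar l) W).map
        (fun p => (wordEval x p.1).trace * (wordEval x p.2).trace)).sum := by
  simp_rw [letterDeriv_wordEval]
  generalize splits (letterBar l) W = L
  induction L with
  | nil => simp
  | cons p L ih =>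
    simp only [List.map_cons, List.sum_cons, Finset.sum_add_distrib, ih]
    congr 1
    simp only [Matrix.trace, Matrix.diag_apply]
    rw [Finset.sum_comm, Finset.sum_mul_sum]

/-- Integration by parts against the first letter of a word. -/
theorem integral_trace_cons_mul (v : ℝ≥0) (l : α × Bool) (W : List (α × Bool))
    {Q : (α × n × n → ℂ) → ℂ} (hQ : Q.HasTemperateGrowth) :
    ∫ x, (wordEval x (l :: W)).trace * Q x ∂(gaussianPi (α × n × n) v) =
      v * ∫ x, (((splits (letterBar l) W).map
        (fun p => (wordEval x p.1).trace * (wordEval x p.2).trace)).sum * Q x +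
        ∑ a, ∑ b, wordEval x W b a * letterDeriv l a b Q x) ∂(gaussianPi (α × n × n) v) := by
  have hWQ : ∀ a b, (fun x : α × n × n → ℂ => wordEval x W b a * Q x).HasTemperateGrowth :=
    fun a b => (hasTemperateGrowth_wordEval W b a).fun_mul hQ
  have hG : ∀ a b, (fun x : α × n × n → ℂ =>
      letterMat x l a b * (wordEval x W b a * Q x)).HasTemperateGrowth :=
    fun a b => (hasTemperateGrowth_letterMat l a b).fun_mul (hWQ a b)
  have hD : ∀ a b, Integrable (letterDeriv l a b (fun x : α × n × n → ℂ => wordEval x W b a * Q x))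
      (gaussianPi (α × n × n) v) := fun a b =>
    (hasTemperateGrowth_letterDeriv (hWQ a b) l a b).integrable _
  have h1 : ∀ x : α × n × n → ℂ, (wordEval x (l :: W)).trace * Q x =
      ∑ a, ∑ b, letterMat x l a b * (wordEval x W b a * Q x) := by
    intro x
    simp only [wordEval_cons, Matrix.trace, Matrix.diag_apply, Matrix.mul_apply, Finset.sum_mul,
      mul_assoc]
  have h2 : ∀ x : α × n × n → ℂ, ((splits (letterBar l) W).map
        (fun p => (wordEval x p.1).trace * (wordEval x p.2).trace)).sum * Q x +
        ∑ a, ∑ b, wordEval x W b a * letterDeriv l a b Q x =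
      ∑ a, ∑ b, letterDeriv l a b (fun x : α × n × n → ℂ => wordEval x W b a * Q x) x := by
    intro x
    rw [← sum_letterDeriv_wordEval]
    simp_rw [letterDeriv_mul (hasTemperateGrowth_wordEval W _ _) hQ, Finset.sum_add_distrib,
      Finset.sum_mul]
  simp_rw [h1, h2]
  rw [integral_finsetSum _ fun a _ => integrable_finsetSum _ fun b _ => (hG a b).integrable _,
    integral_finsetSum _ fun a _ => integrable_finsetSum _ fun b _ => hD a b, Finset.mul_sum]
  refine Finset.sum_congr rfl fun a _ => ?_
  rw [integral_finsetSum _ fun b _ => (hG a b).integrable _,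
    integral_finsetSum _ fun b _ => hD a b, Finset.mul_sum]
  refine Finset.sum_congr rfl fun b _ => ?_
  exact integral_coordStar_mul (hWQ a b) v l.2 _

/-- The normalized trace of a word. -/
noncomputable def normTrace (x : α × n × n → ℂ) (W : List (α × Bool)) : ℂ :=
  (Fintype.card n : ℂ)⁻¹ * (wordEval x W).trace

theorem hasTemperateGrowth_normTrace (W : List (α × Bool)) :
    (fun x : α × n × n → ℂ => normTrace x W).HasTemperateGrowth :=
  (Function.HasTemperateGrowth.const _).fun_mul (hasTemperateGrowth_trace W)

theorem hasTemperateGrowth_prod_normTrace (Vs : List (List (α × Bool))) :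
    (fun x : α × n × n → ℂ => (Vs.map (normTrace x)).prod).HasTemperateGrowth :=
  Function.HasTemperateGrowth.list_prod_map hasTemperateGrowth_normTrace Vs

/-- The list of all ways to pick one element of a list, with the list of the others. -/
def picks {β : Type*} : List β → List (β × List β)
  | [] => []
  | h :: t => (h, t) :: (picks t).map (fun p => (p.1, h :: p.2))

theorem perm_of_mem_picks {β : Type*} {L : List β} {p : β × List β} (hp : p ∈ picks L) :
    L.Perm (p.1 :: p.2) := by
  induction L generalizing p with
  | nil => simp [picks] at hp
  | cons h t ih =>
    simp only [picks, List.mem_cons, List.mem_map] at hp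
    rcases hp with rfl | ⟨q, hq, rfl⟩
    · rfl
    · exact ((ih hq).cons h).trans (List.Perm.swap _ _ _)

/-- A contraction between `W` and another trace merges the two into one. The factor `1/N` of the
differentiated trace becomes that of the merged trace, so no power of `N` appears. -/
theorem sum_wordEval_mul_letterDeriv_prod (l : α × Bool) (W : List (α × Bool))
    (Vs : List (List (α × Bool))) (x : α × n × n → ℂ) :
    ∑ a, ∑ b, wordEval x W b a *
        letterDeriv l a b (fun x => (Vs.map (normTrace x)).prod) x =
      ((picks Vs).map (fun q => ((splits (letterBar l) q.1).map
        (fun p => normTrace x (W ++ (p.2 ++ p.1)) * (q.2.map (normTrace x)).prod)).sum)).sum := by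
  induction Vs with
  | nil =>
    simp only [List.map_nil, List.prod_nil, picks, List.sum_nil, letterDeriv, wirtinger_const]
    simp
  | cons V Vs ih =>
    simp only [List.map_cons, List.prod_cons, picks, List.sum_cons, List.map_map]
    simp_rw [letterDeriv_mul (hasTemperateGrowth_normTrace V)
      (hasTemperateGrowth_prod_normTrace Vs), mul_add, Finset.sum_add_distrib]
    congr 1
    · simp only [normTrace]
      simp_rw [letterDeriv_const_mul (hasTemperateGrowth_trace V), letterDeriv_trace]
      generalize splits (letterBar l) V = L
      induction L with
      | nil => simp
      | cons p L ihL =>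
        simp only [List.map_cons, List.sum_cons, add_mul, mul_add, Finset.sum_add_distrib]
        rw [← ihL]
        congr 1
        rw [← sum_wordEval_mul_wordEval, Finset.mul_sum, Finset.sum_mul]
        refine Finset.sum_congr rfl fun a _ => ?_
        rw [Finset.mul_sum, Finset.sum_mul]
        exact Finset.sum_congr rfl fun b _ => by ring
    · have h1 : ∀ a b, wordEval x W b a * (normTrace x V *
          letterDeriv l a b (fun x => (Vs.map (normTrace x)).prod) x) =
          normTrace x V * (wordEval x W b a *
            letterDeriv l a b (fun x => (Vs.map (normTrace x)).prod) x) := fun a b => by ring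
      simp_rw [h1, ← Finset.mul_sum, ih]
      rw [← List.sum_map_mul_left]
      congr 1
      refine List.map_congr_left fun q _ => ?_
      rw [← List.sum_map_mul_left]
      congr 1
      refine List.map_congr_left fun p _ => ?_
      simp only [List.map_cons, List.prod_cons]
      ring

/-- The joint moments of normalized traces of words. -/
noncomputable def traceMoment (n : Type*) [Fintype n] [DecidableEq n]
    (Vs : List (List (α × Bool))) : ℂ :=
  ∫ x, (Vs.map (normTrace x)).prod
    ∂(gaussianPi (α × n × n) (1 / (Fintype.card n : ℝ≥0)))

/-- The Schwinger–Dyson equation. -/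
theorem traceMoment_cons [Nonempty n] (l : α × Bool) (W : List (α × Bool))
    (Vs : List (List (α × Bool))) :
    traceMoment n ((l :: W) :: Vs) =
      ((splits (letterBar l) W).map (fun p => traceMoment n (p.1 :: p.2 :: Vs))).sum +
      ((Fintype.card n : ℂ)⁻¹) ^ 2 * ((picks Vs).map (fun q => ((splits (letterBar l) q.1).map
        (fun p => traceMoment n ((W ++ (p.2 ++ p.1)) :: q.2))).sum)).sum := by
  set μ := gaussianPi (α × n × n) (1 / (Fintype.card n : ℝ≥0)) with hμ
  have hN : (Fintype.card n : ℂ) ≠ 0 := by exact_mod_cast Fintype.card_ne_zero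
  have hint : ∀ Vs : List (List (α × Bool)),
      Integrable (fun x : α × n × n → ℂ => (Vs.map (normTrace x)).prod) μ := fun Vs =>
    (hasTemperateGrowth_prod_normTrace Vs).integrable _
  have h1 : traceMoment n ((l :: W) :: Vs) = (Fintype.card n : ℂ)⁻¹ *
      ∫ x, (wordEval x (l :: W)).trace * (Vs.map (normTrace x)).prod ∂μ := by
    rw [traceMoment, ← integral_const_mul]
    congr 1
    funext x
    simp only [List.map_cons, List.prod_cons]
    rw [normTrace, mul_assoc]
  rw [h1, hμ, integral_trace_cons_mul _ l W (hasTemperateGrowth_prod_normTrace Vs), ← hμ]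
  simp_rw [sum_wordEval_mul_letterDeriv_prod]
  have hA := integral_list_sum_map (μ := μ)
    (f := fun (p : List (α × Bool) × List (α × Bool)) (x : α × n × n → ℂ) =>
      ((p.1 :: p.2 :: Vs).map (normTrace x)).prod) (fun p => hint _) (splits (letterBar l) W)
  have hB1 : ∀ q : List (α × Bool) × List (List (α × Bool)), _ := fun q =>
    integral_list_sum_map (μ := μ)
    (f := fun (p : List (α × Bool) × List (α × Bool)) (x : α × n × n → ℂ) =>
      (((W ++ (p.2 ++ p.1)) :: q.2).map (normTrace x)).prod) (fun p => hint _)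
      (splits (letterBar l) q.1)
  have hB := integral_list_sum_map (μ := μ) (fun q => (hB1 q).1) (picks Vs)
  -- Splitting creates two traces whose normalization yields `N²`, cancelling the `N⁻¹` of the
  -- original trace and the variance `N⁻¹`; the merging terms keep the full `N⁻²`.
  have h2 : ∀ x : α × n × n → ℂ, ((splits (letterBar l) W).map
        (fun p => (wordEval x p.1).trace * (wordEval x p.2).trace)).sum *
        (Vs.map (normTrace x)).prod = (Fintype.card n : ℂ) ^ 2 * ((splits (letterBar l) W).map
        (fun p => ((p.1 :: p.2 :: Vs).map (normTrace x)).prod)).sum := by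
    intro x
    rw [← List.sum_map_mul_left, ← List.sum_map_mul_right]
    congr 1
    refine List.map_congr_left fun p _ => ?_
    simp only [List.map_cons, List.prod_cons, normTrace]
    field_simp
  simp_rw [h2]
  simp only [List.map_cons, List.prod_cons] at hA hB hB1 ⊢
  rw [integral_add (hA.1.const_mul _) hB.1, integral_const_mul, hA.2, hB.2]
  simp_rw [fun q => (hB1 q).2]
  simp only [traceMoment, ← hμ, List.map_cons, List.prod_cons]
  push_cast
  field_simp

end MatrixWords

/-! ### Limits of trace moments and concentration of normalized traces. -/

section Limit

open Topology

theorem tendsto_list_sum_map {κ γ : Type*} {l : Filter γ} {f : κ → γ → ℂ} {g : κ → ℂ}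
    {L : List κ} (h : ∀ k ∈ L, Tendsto (f k) l (𝓝 (g k))) :
    Tendsto (fun c => (L.map (fun k => f k c)).sum) l (𝓝 (L.map g).sum) := by
  induction L with
  | nil => simpa using tendsto_const_nhds
  | cons a t ih =>
    simp only [List.map_cons, List.sum_cons]
    exact (h a (by simp)).add (ih fun k hk => h k (by simp [hk]))

variable {α : Type*} [DecidableEq α]

/-- The limiting normalized trace of a `*`-word: the `*`-distribution of free circular elements. -/
noncomputable def wordLimit : List (α × Bool) → ℂ
  | [] => 1
  | l :: W =>
    ((splits (letterBar l) W).attach.map (fun p => wordLimit p.1.1 * wordLimit p.1.2)).sum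
termination_by W => W.length
decreasing_by
  all_goals
    have := length_of_mem_splits p.2
    simp only [List.length_cons]
    omega

theorem wordLimit_nil : wordLimit ([] : List (α × Bool)) = 1 := by
  rw [wordLimit]

theorem wordLimit_cons (l : α × Bool) (W : List (α × Bool)) :
    wordLimit (l :: W) =
      ((splits (letterBar l) W).map (fun p => wordLimit p.1 * wordLimit p.2)).sum := by
  rw [wordLimit]
  congr 1
  exact List.attach_map_val (f := fun p : List (α × Bool) × List (α × Bool) =>
    wordLimit p.1 * wordLimit p.2)

/-- In the Schwinger–Dyson equation the merging terms carry `N⁻²` and vanish, while the splitting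
terms reproduce the recursion of `wordLimit` in the first word alone; hence the limit factorizes. -/
theorem tendsto_traceMoment [Fintype α] (Vs : List (List (α × Bool))) :
    Tendsto (fun N : ℕ => traceMoment (Fin N) Vs) atTop (𝓝 (Vs.map wordLimit).prod) := by
  -- The number of letters plus the number of words decreases: splitting removes two letters and
  -- adds one word, merging removes two letters and one word, and an empty word is simply dropped.
  generalize hm : (Vs.map List.length).sum + Vs.length = m
  induction m using Nat.strong_induction_on generalizing Vs with
  | _ m ih =>
    rcases Vs with _ | ⟨W, Vs⟩
    · simp [traceMoment]
    · rcases W with _ | ⟨l, W⟩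
      · have h1 : Tendsto (fun N : ℕ => traceMoment (Fin N) Vs) atTop
            (𝓝 (Vs.map wordLimit).prod) :=
          ih _ (by simp at hm; omega) Vs rfl
        simp only [List.map_cons, List.prod_cons, wordLimit_nil, one_mul]
        refine h1.congr' ?_
        filter_upwards [eventually_gt_atTop 0] with N hN
        have : (N : ℂ) ≠ 0 := by exact_mod_cast hN.ne'
        simp [traceMoment, normTrace, wordEval_nil, this]
      · simp only [List.map_cons, List.length_cons, List.sum_cons] at hm
        have h1 : Tendsto (fun N : ℕ => ((splits (letterBar l) W).map
            (fun p => traceMoment (Fin N) (p.1 :: p.2 :: Vs))).sum) atTop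
            (𝓝 ((splits (letterBar l) W).map
              (fun p => ((p.1 :: p.2 :: Vs).map wordLimit).prod)).sum) := by
          refine tendsto_list_sum_map fun p hp => ih _ ?_ _ rfl
          have := length_of_mem_splits hp
          simp only [List.map_cons, List.length_cons, List.sum_cons]
          omega
        have h2 : Tendsto (fun N : ℕ => ((picks Vs).map (fun q =>
            ((splits (letterBar l) q.1).map
              (fun p => traceMoment (Fin N) ((W ++ (p.2 ++ p.1)) :: q.2))).sum)).sum) atTop
            (𝓝 ((picks Vs).map (fun q => ((splits (letterBar l) q.1).map
              (fun p => (((W ++ (p.2 ++ p.1)) :: q.2).map wordLimit).prod)).sum)).sum) := by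
          refine tendsto_list_sum_map fun q hq => tendsto_list_sum_map fun p hp => ih _ ?_ _ rfl
          have h3 := length_of_mem_splits hp
          have h4 := (perm_of_mem_picks hq).length_eq
          have h5 := ((perm_of_mem_picks hq).map List.length).sum_eq
          simp only [List.map_cons, List.length_cons, List.sum_cons, List.length_append] at h4 h5 ⊢
          omega
        have h3 : Tendsto (fun N : ℕ => ((Fintype.card (Fin N) : ℂ)⁻¹) ^ 2) atTop (𝓝 0) := by
          have := (tendsto_inv_atTop_nhds_zero_nat (𝕜 := ℂ)).pow 2
          simpa using this
        have h4 := h1.add (h3.mul h2)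
        have h5 : ((splits (letterBar l) W).map
              (fun p => ((p.1 :: p.2 :: Vs).map wordLimit).prod)).sum =
            (((l :: W) :: Vs).map wordLimit).prod := by
          simp only [List.map_cons, List.prod_cons, wordLimit_cons]
          rw [← List.sum_map_mul_right]
          congr 1
          exact List.map_congr_left fun p _ => (mul_assoc _ _ _).symm
        rw [zero_mul, add_zero, h5] at h4
        refine h4.congr' ?_
        filter_upwards [eventually_gt_atTop 0] with N hN
        have : Nonempty (Fin N) := ⟨⟨0, hN⟩⟩
        rw [traceMoment_cons]

/-- A word without adjoints. -/
def plainWord (A : List α) : List (α × Bool) := A.map (fun a => (a, false))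

/-- The adjoint of a word without adjoints. -/
def starWord (A : List α) : List (α × Bool) := (A.map (fun a => (a, true))).reverse

theorem plainWord_cons (a : α) (A : List α) : plainWord (a :: A) = (a, false) :: plainWord A := rfl

theorem starWord_cons (a : α) (A : List α) : starWord (a :: A) = starWord A ++ [(a, true)] := by
  simp [starWord]

theorem starWord_append (A B : List α) : starWord (A ++ B) = starWord B ++ starWord A := by
  simp [starWord]

theorem splits_plainWord_true (a : α) (A : List α) : splits (a, true) (plainWord A) = [] :=
  splits_eq_nil (by simp [plainWord])

/-- In a nonempty word of adjoints the first letter has no partner. -/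
theorem wordLimit_starWord (B : List α) : wordLimit (starWord B) = if B = [] then 1 else 0 := by
  induction B using List.reverseRecOn with
  | nil => simp [starWord, wordLimit_nil]
  | append_singleton B b _ =>
    rw [starWord_append, starWord_cons]
    simp only [starWord, List.map_nil, List.reverse_nil, List.nil_append, List.singleton_append]
    rw [wordLimit_cons, splits_eq_nil]
    · simp
    · simp [letterBar]

/-- The first letter `a` must pair with the last letter of the word, since any earlier partner
leaves behind a nonempty word of adjoints, of limit `0`. So `A` and `B` are compared letter by
letter. -/
theorem wordLimit_plainWord_append_starWord (A B : List α) :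
    wordLimit (plainWord A ++ starWord B) = if A = B then 1 else 0 := by
  induction A generalizing B with
  | nil =>
    simp only [plainWord, List.map_nil, List.nil_append, wordLimit_starWord, eq_comm]
  | cons a A ih =>
    rw [plainWord_cons, List.cons_append, wordLimit_cons, letterBar, Bool.not_false,
      splits_append, splits_plainWord_true]
    rcases B with _ | ⟨b, B⟩
    · simp [starWord, splits]
    · rw [starWord_cons, splits_append]
      have h0 : ((splits (a, true) (starWord B)).map (fun p =>
          wordLimit (plainWord A ++ p.1) * wordLimit (p.2 ++ [(b, true)]))).sum = 0 := by
        apply List.sum_eq_zero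
        intro z hz
        simp only [List.mem_map] at hz
        obtain ⟨p, hp, rfl⟩ := hz
        have hp2 : ∀ y ∈ p.2, y.2 = true := by
          intro y hy
          have : y ∈ starWord B := by
            rw [eq_append_of_mem_splits hp]
            simp [hy]
          simp only [starWord, List.mem_reverse, List.mem_map] at this
          obtain ⟨c, _, rfl⟩ := this
          rfl
        have : wordLimit (p.2 ++ [(b, true)]) = 0 := by
          rcases h : p.2 with _ | ⟨y, Y⟩
          · simp [wordLimit_cons, splits]
          · rw [List.cons_append, wordLimit_cons, splits_eq_nil, List.map_nil, List.sum_nil]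
            have hy : y.2 = true := hp2 y (by simp [h])
            simp only [letterBar, hy, List.mem_append, List.mem_singleton, Prod.mk.injEq]
            rintro (h' | h')
            · have := hp2 _ (h ▸ List.mem_cons_of_mem y h')
              simp at this
            · simp at h'
        simp [this]
      simp only [List.map_append, List.map_map, List.sum_append, List.map_nil, List.nil_append,
        Function.comp_def, h0, zero_add]
      by_cases hab : b = a
      · subst hab
        simp [splits, ih, wordLimit_nil]
      · have hab' : a ≠ b := fun h => hab h.symm
        simp [splits, hab, hab']

theorem conjTranspose_letterMat {n : Type*} (x : α × n × n → ℂ) (l : α × Bool) :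
    (letterMat x l).conjTranspose = letterMat x (letterBar l) := by
  ext a b
  obtain ⟨r, s⟩ := l
  cases s <;> simp [letterMat, letterBar, coordStar]

theorem conjTranspose_wordEval [Fintype α] {n : Type*} [Fintype n] [DecidableEq n] (x : α × n × n → ℂ)
    (W : List (α × Bool)) :
    (wordEval x W).conjTranspose = wordEval x (W.map letterBar).reverse := by
  induction W with
  | nil => simp [wordEval_nil]
  | cons l W ih =>
    rw [wordEval_cons, Matrix.conjTranspose_mul, ih, conjTranspose_letterMat, List.map_cons,
      List.reverse_cons, wordEval_append]
    simp [wordEval]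

theorem map_letterBar_reverse_plainWord (A : List α) :
    ((plainWord A).map letterBar).reverse = starWord A := by
  simp [plainWord, starWord, letterBar, Function.comp_def]

theorem map_letterBar_reverse_starWord (A : List α) :
    ((starWord A).map letterBar).reverse = plainWord A := by
  simp [plainWord, starWord, letterBar, Function.comp_def]

theorem star_trace_wordEval [Fintype α] {n : Type*} [Fintype n] [DecidableEq n] (x : α × n × n → ℂ)
    (W : List (α × Bool)) :
    starRingEnd ℂ (wordEval x W).trace = (wordEval x (W.map letterBar).reverse).trace := by
  rw [← conjTranspose_wordEval, Matrix.trace_conjTranspose]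
  rfl

theorem star_normTrace [Fintype α] {n : Type*} [Fintype n] [DecidableEq n] (x : α × n × n → ℂ)
    (W : List (α × Bool)) :
    starRingEnd ℂ (normTrace x W) = normTrace x (W.map letterBar).reverse := by
  rw [normTrace, map_mul, star_trace_wordEval, normTrace]
  simp

theorem sq_integral_le_integral_sq {X : Type*} [MeasurableSpace X] {μ : Measure X}
    [IsProbabilityMeasure μ] {f : X → ℝ} (hf : AEStronglyMeasurable f μ)
    (h2 : Integrable (fun x => f x ^ 2) μ) : (∫ x, f x ∂μ) ^ 2 ≤ ∫ x, f x ^ 2 ∂μ := by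
  have h := variance_nonneg f μ
  rw [variance_eq_sub ((memLp_two_iff_integrable_sq hf).2 h2)] at h
  simpa using h

/-- Mixed words `A B*` have normalized traces concentrating at `1` if `A = B` and at `0`
otherwise. -/
theorem tendsto_integral_norm_normTrace_sub [Fintype α] (A B : List α) :
    Tendsto (fun N : ℕ => ∫ x : α × Fin N × Fin N → ℂ,
      ‖normTrace x (plainWord A ++ starWord B) - (if A = B then 1 else 0)‖
        ∂(gaussianPi (α × Fin N × Fin N) (1 / (N : ℝ≥0)))) atTop (𝓝 0) := by
  set c : ℂ := if A = B then 1 else 0 with hc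
  have hcc : starRingEnd ℂ c = c := by rw [hc]; split_ifs <;> simp
  have hc2 : c * c = c := by rw [hc]; split_ifs <;> simp
  set W := plainWord A ++ starWord B with hW
  set W' := plainWord B ++ starWord A with hW'
  have hWW : (W.map letterBar).reverse = W' := by
    rw [hW, List.map_append, List.reverse_append, map_letterBar_reverse_plainWord,
      map_letterBar_reverse_starWord]
  have hlW : wordLimit W = c := wordLimit_plainWord_append_starWord A B
  have hlW' : wordLimit W' = c := by
    rw [hW', wordLimit_plainWord_append_starWord, hc]
    simp only [eq_comm]
  have hg : ∀ N : ℕ, (fun x : α × Fin N × Fin N → ℂ => normTrace x W - c).HasTemperateGrowth :=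
    fun N => (hasTemperateGrowth_normTrace W).fun_sub (Function.HasTemperateGrowth.const c)
  -- The conjugate of the normalized trace of `W` is that of `W'`, and `c`, being `0` or `1`, is
  -- real and idempotent; thus the squared deviation is a combination of trace moments.
  have hsq : ∀ (N : ℕ) (x : α × Fin N × Fin N → ℂ), ((‖normTrace x W - c‖ ^ 2 : ℝ) : ℂ) =
      ([W, W'].map (normTrace x)).prod - c * ([W].map (normTrace x)).prod -
        c * ([W'].map (normTrace x)).prod + c := by
    intro N x
    have h1 : ((‖normTrace x W - c‖ ^ 2 : ℝ) : ℂ) =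
        (normTrace x W - c) * (normTrace x W' - c) := by
      rw [← hWW, ← star_normTrace, ← hcc, ← map_sub, hcc, Complex.mul_conj']
      simp
    rw [h1]
    simp only [List.map_cons, List.map_nil, List.prod_cons, List.prod_nil, mul_one]
    linear_combination hc2
  have hint : ∀ (N : ℕ) (Vs : List (List (α × Bool))),
      Integrable (fun x : α × Fin N × Fin N → ℂ => (Vs.map (normTrace x)).prod)
        (gaussianPi (α × Fin N × Fin N) (1 / (N : ℝ≥0))) := fun N Vs =>
    (hasTemperateGrowth_prod_normTrace Vs).integrable _
  have hisq : ∀ N : ℕ, Integrable (fun x : α × Fin N × Fin N → ℂ => ‖normTrace x W - c‖ ^ 2)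
      (gaussianPi (α × Fin N × Fin N) (1 / (N : ℝ≥0))) := by
    intro N
    have h1 := ((hg N).fun_mul (hg N)).integrable
      (gaussianPi (α × Fin N × Fin N) (1 / (N : ℝ≥0)))
    refine h1.norm.congr (Eventually.of_forall fun x => ?_)
    simp [sq]
  have hE : ∀ N : ℕ, ((∫ x : α × Fin N × Fin N → ℂ, ‖normTrace x W - c‖ ^ 2
      ∂(gaussianPi (α × Fin N × Fin N) (1 / (N : ℝ≥0))) : ℝ) : ℂ) =
      traceMoment (Fin N) [W, W'] - c * traceMoment (Fin N) [W] - c * traceMoment (Fin N) [W']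
        + c := by
    intro N
    rw [← integral_complex_ofReal]
    simp_rw [hsq]
    have i1 := (hint N [W]).const_mul c
    have i2 := (hint N [W']).const_mul c
    have i3 := (hint N [W, W']).sub i1
    have i4 := i3.sub i2
    simp only [Pi.sub_def] at i3 i4
    rw [integral_add i4 (integrable_const _), integral_sub i3 i2, integral_sub (hint N _) i1,
      integral_const_mul, integral_const_mul]
    simp [traceMoment]
  -- The joint moment of `W` and `W'` factorizes in the limit, leaving `c² - c² - c² + c = 0`.
  have hlim : Tendsto (fun N : ℕ => ∫ x : α × Fin N × Fin N → ℂ, ‖normTrace x W - c‖ ^ 2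
      ∂(gaussianPi (α × Fin N × Fin N) (1 / (N : ℝ≥0)))) atTop (𝓝 0) := by
    have h1 := (((tendsto_traceMoment [W, W']).sub
      ((tendsto_traceMoment [W]).const_mul c)).sub ((tendsto_traceMoment [W']).const_mul c)).add
        (tendsto_const_nhds (x := c))
    simp_rw [← hE] at h1
    have h2 : ([W, W'].map wordLimit).prod - c * ([W].map wordLimit).prod -
        c * ([W'].map wordLimit).prod + c = 0 := by
      simp [hlW, hlW', hc2]
    rw [h2] at h1
    have h3 := (Complex.continuous_re.tendsto 0).comp h1
    simpa [Function.comp_def] using h3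
  have hle : ∀ N : ℕ, ∫ x : α × Fin N × Fin N → ℂ, ‖normTrace x W - c‖
        ∂(gaussianPi (α × Fin N × Fin N) (1 / (N : ℝ≥0))) ≤
      √(∫ x : α × Fin N × Fin N → ℂ, ‖normTrace x W - c‖ ^ 2
        ∂(gaussianPi (α × Fin N × Fin N) (1 / (N : ℝ≥0)))) := by
    intro N
    exact Real.le_sqrt_of_sq_le (sq_integral_le_integral_sq
      (hg N).1.continuous.norm.aestronglyMeasurable (hisq N))
  refine squeeze_zero (fun N => integral_nonneg fun x => norm_nonneg _) hle ?_
  simpa using hlim.sqrt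

end Limit

/-! ### The approximate differential equation for the characteristic function. -/

section CharFun

open Topology

theorem hasDerivAt_integral_cexp {X : Type*} [MeasurableSpace X] {μ : Measure X}
    [IsFiniteMeasure μ] {Y : X → ℝ} (hY : Integrable Y μ) (s : ℝ) :
    HasDerivAt (fun s : ℝ => ∫ x, Complex.exp (s * Y x * Complex.I) ∂μ)
      (∫ x, Y x * Complex.I * Complex.exp (s * Y x * Complex.I) ∂μ) s := by
  have hmeas : ∀ s : ℝ, AEStronglyMeasurable (fun x => Complex.exp (s * Y x * Complex.I)) μ := by
    intro s
    have h1 : Continuous (fun y : ℝ => Complex.exp (s * y * Complex.I)) := by fun_prop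
    exact h1.comp_aestronglyMeasurable hY.1
  have hnorm : ∀ s y : ℝ, ‖Complex.exp (s * y * Complex.I)‖ = 1 := by
    intro s y
    rw [← Complex.ofReal_mul, Complex.norm_exp_ofReal_mul_I]
  refine (hasDerivAt_integral_of_dominated_loc_of_deriv_le (bound := fun x => ‖Y x‖)
    (F := fun (s : ℝ) x => Complex.exp (s * Y x * Complex.I))
    (F' := fun (s : ℝ) x => Y x * Complex.I * Complex.exp (s * Y x * Complex.I))
    (s := Set.univ) univ_mem (Eventually.of_forall hmeas) ?_ ?_ ?_ hY.norm ?_).2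
  · exact Integrable.of_bound (hmeas s) 1 (Eventually.of_forall fun x => (hnorm s _).le)
  · exact ((Complex.continuous_ofReal.comp_aestronglyMeasurable hY.1).mul_const _).mul (hmeas s)
  · refine Eventually.of_forall fun x t _ => ?_
    simp [hnorm]
  · refine Eventually.of_forall fun x t _ => ?_
    have h1 : HasDerivAt (fun t : ℝ => (t * Y x * Complex.I : ℂ)) (1 * Y x * Complex.I) t :=
      ((Complex.ofRealCLM.hasDerivAt (x := t)).mul_const _).mul_const _
    refine h1.cexp.congr_deriv ?_
    ring

/-- The integrating factor `exp(κ s² / 4)` turns the approximate equation `φ' ≈ -(s κ / 2) φ` into a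
small derivative on `[0, 1]`, and the mean value inequality concludes. -/
theorem norm_mul_cexp_sub_one_le {φ φ' : ℝ → ℂ} (hφ : ∀ s, HasDerivAt φ (φ' s) s)
    (h0 : φ 0 = 1) {κ ε : ℝ} (hκ : 0 ≤ κ) (hε : 0 ≤ ε)
    (h : ∀ s, ‖φ' s + (s * κ / 2 : ℝ) * φ s‖ ≤ |s| * ε) :
    ‖φ 1 * Real.exp (κ / 4) - 1‖ ≤ ε * Real.exp (κ / 4) := by
  have hψ : ∀ s, HasDerivAt (fun s => φ s * (Real.exp (κ * s ^ 2 / 4) : ℂ))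
      ((φ' s + (s * κ / 2 : ℝ) * φ s) * (Real.exp (κ * s ^ 2 / 4) : ℂ)) s := by
    intro s
    have h1 : HasDerivAt (fun s : ℝ => κ * s ^ 2 / 4) (s * κ / 2) s := by
      refine (((hasDerivAt_pow 2 s).const_mul κ).div_const 4).congr_deriv ?_
      simp
      ring
    refine ((hφ s).mul h1.exp.ofReal_comp).congr_deriv ?_
    push_cast
    ring
  have h1 := norm_image_sub_le_of_norm_deriv_le_segment_01'
    (fun s _ => (hψ s).hasDerivWithinAt) (C := ε * Real.exp (κ / 4)) (by
      intro s hs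
      rw [norm_mul]
      have h2 : ‖(Real.exp (κ * s ^ 2 / 4) : ℂ)‖ ≤ Real.exp (κ / 4) := by
        rw [Complex.norm_real, Real.norm_eq_abs, abs_of_pos (Real.exp_pos _), Real.exp_le_exp]
        have : s ^ 2 ≤ 1 := pow_le_one₀ hs.1 hs.2.le
        nlinarith
      refine mul_le_mul ((h s).trans ?_) h2 (norm_nonneg _) hε
      rw [abs_of_nonneg hs.1]
      exact mul_le_of_le_one_left hε hs.2.le)
  simpa [h0] using h1

variable {α : Type*} [Fintype α] [DecidableEq α]

theorem tendsto_integral_norm_list_sum {κ : Type*} {X : ℕ → Type*} [∀ N, MeasurableSpace (X N)]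
    (μ : (N : ℕ) → Measure (X N)) (L : List κ) {f : κ → (N : ℕ) → X N → ℂ}
    (hf : ∀ k N, Integrable (f k N) (μ N))
    (h : ∀ k ∈ L, Tendsto (fun N => ∫ x, ‖f k N x‖ ∂(μ N)) atTop (𝓝 0)) :
    Tendsto (fun N => ∫ x, ‖(L.map (fun k => f k N x)).sum‖ ∂(μ N)) atTop (𝓝 0) := by
  induction L with
  | nil => simp
  | cons a t ih =>
    have h1 := (h a (by simp)).add (ih fun k hk => h k (by simp [hk]))
    rw [add_zero] at h1
    refine squeeze_zero (fun N => integral_nonneg fun x => norm_nonneg _) (fun N => ?_) h1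
    have hi := (integral_list_sum_map (fun k => hf k N) t).1
    rw [← integral_add (hf a N).norm hi.norm]
    refine integral_mono_of_nonneg (Eventually.of_forall fun x => norm_nonneg _)
      ((hf a N).norm.add hi.norm) (Eventually.of_forall fun x => ?_)
    simpa using norm_add_le _ _

section LinearCombination

variable {κ : Type*} [Fintype κ] (u : κ → List α) (c : κ → ℂ)

/-- The real linear combination `∑ Re (c j * Tr (G_{u j}))`. -/
noncomputable def traceComb {n : Type*} [Fintype n] [DecidableEq n] (x : α × n × n → ℂ) : ℝ :=
  ∑ j, (c j * (wordEval x (plainWord (u j))).trace).re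

variable {n : Type*} [Fintype n] [DecidableEq n]

theorem star_trace_plainWord (x : α × n × n → ℂ) (A : List α) :
    starRingEnd ℂ (wordEval x (plainWord A)).trace = (wordEval x (starWord A)).trace := by
  rw [star_trace_wordEval, map_letterBar_reverse_plainWord]

theorem traceComb_eq (x : α × n × n → ℂ) :
    (traceComb u c x : ℂ) = ∑ j, (c j / 2 * (wordEval x (plainWord (u j))).trace +
      starRingEnd ℂ (c j) / 2 * (wordEval x (starWord (u j))).trace) := by
  rw [traceComb, Complex.ofReal_sum]
  refine Finset.sum_congr rfl fun j _ => ?_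
  rw [Complex.re_eq_add_conj, map_mul, star_trace_plainWord]
  ring

theorem hasTemperateGrowth_traceComb_ofReal :
    (fun x : α × n × n → ℂ => (traceComb u c x : ℂ)).HasTemperateGrowth := by
  simp_rw [traceComb_eq]
  exact Function.HasTemperateGrowth.sum fun j _ =>
    ((Function.HasTemperateGrowth.const _).fun_mul (hasTemperateGrowth_trace _)).fun_add
      ((Function.HasTemperateGrowth.const _).fun_mul (hasTemperateGrowth_trace _))

theorem hasTemperateGrowth_traceComb :
    (traceComb u c : (α × n × n → ℂ) → ℝ).HasTemperateGrowth :=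
  Complex.reCLM.hasTemperateGrowth.comp (hasTemperateGrowth_traceComb_ofReal u c)

/-- Only the conjugate half of `traceComb` contains adjoint letters, so the plain half is
annihilated. Reversal turns occurrences in the adjoint word into occurrences in `u l`. -/
theorem letterDeriv_traceComb (a : α) (p q : n) (x : α × n × n → ℂ) :
    letterDeriv (a, false) p q (fun x => (traceComb u c x : ℂ)) x =
      ∑ l, starRingEnd ℂ (c l) / 2 * ((splits a (u l)).map
        (fun r => wordEval x (starWord (r.2 ++ r.1)) p q)).sum := by
  simp_rw [traceComb_eq]
  have hT : ∀ W : List (α × Bool), ∀ d : ℂ,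
      (fun x : α × n × n → ℂ => d * (wordEval x W).trace).HasTemperateGrowth := fun W d =>
    (Function.HasTemperateGrowth.const _).fun_mul (hasTemperateGrowth_trace _)
  have hadd : ∀ (l : κ), letterDeriv (a, false) p q (fun x =>
      c l / 2 * (wordEval x (plainWord (u l))).trace +
        starRingEnd ℂ (c l) / 2 * (wordEval x (starWord (u l))).trace) x =
      letterDeriv (a, false) p q (fun x => c l / 2 * (wordEval x (plainWord (u l))).trace) x +
      letterDeriv (a, false) p q
        (fun x => starRingEnd ℂ (c l) / 2 * (wordEval x (starWord (u l))).trace) x := by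
    intro l
    have := letterDeriv_sum (Finset.univ : Finset Bool) (f := fun s x => if s then
      c l / 2 * (wordEval x (plainWord (u l))).trace else
        starRingEnd ℂ (c l) / 2 * (wordEval x (starWord (u l))).trace)
      (fun s => by cases s <;> simp only [if_true, Bool.false_eq_true, if_false] <;> exact hT _ _)
      (a, false) p q x
    simpa using this
  rw [letterDeriv_sum _ fun l => (hT _ _).fun_add (hT _ _)]
  refine Finset.sum_congr rfl fun l _ => ?_
  rw [hadd, letterDeriv_const_mul (hasTemperateGrowth_trace _),
    letterDeriv_const_mul (hasTemperateGrowth_trace _), letterDeriv_trace, letterDeriv_trace,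
    letterBar, Bool.not_false, splits_plainWord_true, List.map_nil, List.sum_nil, mul_zero,
    zero_add]
  congr 1
  rw [starWord, sum_splits_reverse,
    map_splits_of_injective (f := fun a : α => (a, true)) (fun _ _ h => (Prod.mk.inj h).1),
    List.map_map]
  simp only [Function.comp_def, starWord_append]
  rfl

/-- The kernel produced by integrating `Tr (G_{a A})` by parts. -/
noncomputable def traceKernel (a : α) (A : List α) (x : α × n × n → ℂ) : ℂ :=
  ∑ l, starRingEnd ℂ (c l) * ((splits a (u l)).map
    (fun r => normTrace x (plainWord A ++ starWord (r.2 ++ r.1)))).sum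

/-- There is no contraction inside a `*`-free word, so only the derivative of the exponential
survives; the variance `1/N` becomes the normalization of the resulting traces. -/
theorem integral_trace_mul_cexp (a : α) (A : List α) (s : ℝ) :
    ∫ x, (wordEval x (plainWord (a :: A))).trace *
        Complex.exp (s * traceComb u c x * Complex.I)
          ∂(gaussianPi (α × n × n) (1 / (Fintype.card n : ℝ≥0))) =
      s * Complex.I / 2 * ∫ x, traceKernel u c a A x *
        Complex.exp (s * traceComb u c x * Complex.I)
          ∂(gaussianPi (α × n × n) (1 / (Fintype.card n : ℝ≥0))) := by
  rw [plainWord_cons, integral_trace_cons_mul _ _ _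
    (hasTemperateGrowth_cexp (hasTemperateGrowth_traceComb u c) s), letterBar, Bool.not_false,
    splits_plainWord_true, ← integral_const_mul, ← integral_const_mul]
  congr 1
  funext x
  have h1 : ∀ p q : n, letterDeriv (a, false) p q
      (fun x => Complex.exp (s * traceComb u c x * Complex.I)) x =
      Complex.exp (s * traceComb u c x * Complex.I) * (s * Complex.I *
        letterDeriv (a, false) p q (fun x => (traceComb u c x : ℂ)) x) := fun p q =>
    wirtinger_cexp (hasTemperateGrowth_traceComb_ofReal u c) s _ _ x
  simp_rw [h1, letterDeriv_traceComb]
  have h2 : ∀ L : List (List α × List α),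
      ∑ p, ∑ q, wordEval x (plainWord A) q p * (L.map
        (fun r => wordEval x (starWord (r.2 ++ r.1)) p q)).sum =
      (L.map (fun r => (wordEval x (plainWord A ++ starWord (r.2 ++ r.1))).trace)).sum := by
    intro L
    induction L with
    | nil => simp
    | cons r L ih =>
      simp only [List.map_cons, List.sum_cons, mul_add, Finset.sum_add_distrib, ih,
        sum_wordEval_mul_wordEval]
  have h3 : ∑ p, ∑ q, wordEval x (plainWord A) q p *
      (Complex.exp (s * traceComb u c x * Complex.I) * (s * Complex.I *
        ∑ l, starRingEnd ℂ (c l) / 2 * ((splits a (u l)).map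
          (fun r => wordEval x (starWord (r.2 ++ r.1)) p q)).sum)) =
      Complex.exp (s * traceComb u c x * Complex.I) * (s * Complex.I) *
        ∑ l, starRingEnd ℂ (c l) / 2 * ∑ p, ∑ q, wordEval x (plainWord A) q p *
          ((splits a (u l)).map (fun r => wordEval x (starWord (r.2 ++ r.1)) p q)).sum := by
    simp only [Finset.mul_sum]
    conv_rhs => rw [Finset.sum_comm]
    refine Finset.sum_congr rfl fun p _ => ?_
    conv_rhs => rw [Finset.sum_comm]
    refine Finset.sum_congr rfl fun q _ => Finset.sum_congr rfl fun l _ => ?_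
    ring
  rw [h3]
  simp_rw [h2]
  simp only [List.map_nil, List.sum_nil, zero_mul, zero_add, traceKernel, normTrace,
    Finset.mul_sum, Finset.sum_mul]
  refine Finset.sum_congr rfl fun l _ => ?_
  rw [List.sum_map_mul_left]
  push_cast
  ring

theorem hasTemperateGrowth_traceKernel (a : α) (A : List α) :
    (fun x : α × n × n → ℂ => traceKernel u c a A x).HasTemperateGrowth :=
  Function.HasTemperateGrowth.sum fun _ _ => (Function.HasTemperateGrowth.const _).fun_mul
    (Function.HasTemperateGrowth.list_sum_map (fun _ => hasTemperateGrowth_normTrace _) _)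

/-- The limit of `traceKernel`. -/
noncomputable def traceKernelLimit (a : α) (A : List α) : ℂ :=
  ∑ l, starRingEnd ℂ (c l) * ((splits a (u l)).map
    (fun r => if A = r.2 ++ r.1 then (1 : ℂ) else 0)).sum

theorem tendsto_integral_norm_traceKernel_sub (a : α) (A : List α) :
    Tendsto (fun N : ℕ => ∫ x : α × Fin N × Fin N → ℂ,
      ‖traceKernel u c a A x - traceKernelLimit u c a A‖
        ∂(gaussianPi (α × Fin N × Fin N) (1 / (N : ℝ≥0)))) atTop (𝓝 0) := by
  have hg : ∀ (r : List α × List α) (N : ℕ), (fun x : α × Fin N × Fin N → ℂ =>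
      normTrace x (plainWord A ++ starWord (r.2 ++ r.1)) -
        (if A = r.2 ++ r.1 then 1 else 0)).HasTemperateGrowth := fun r N =>
    (hasTemperateGrowth_normTrace _).fun_sub (Function.HasTemperateGrowth.const _)
  have hrw : ∀ (N : ℕ) (x : α × Fin N × Fin N → ℂ),
      traceKernel u c a A x - traceKernelLimit u c a A =
      ((Finset.univ : Finset κ).toList.map (fun l => starRingEnd ℂ (c l) * ((splits a (u l)).map
        (fun r => normTrace x (plainWord A ++ starWord (r.2 ++ r.1)) -
          (if A = r.2 ++ r.1 then 1 else 0))).sum)).sum := by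
    intro N x
    rw [Finset.sum_map_toList, traceKernel, traceKernelLimit, ← Finset.sum_sub_distrib]
    refine Finset.sum_congr rfl fun l _ => ?_
    rw [← mul_sub]
    congr 1
    generalize splits a (u l) = L
    induction L with
    | nil => simp
    | cons r L ih =>
      simp only [List.map_cons, List.sum_cons]
      rw [← ih]
      ring
  simp_rw [hrw]
  refine tendsto_integral_norm_list_sum
    (fun N : ℕ => gaussianPi (α × Fin N × Fin N) (1 / (N : ℝ≥0))) _
    (f := fun l N x => starRingEnd ℂ (c l) * ((splits a (u l)).map
        (fun r => normTrace x (plainWord A ++ starWord (r.2 ++ r.1)) -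
          (if A = r.2 ++ r.1 then 1 else 0))).sum) (fun l N => ?_) (fun l _ => ?_)
  · exact ((Function.HasTemperateGrowth.list_sum_map (fun r => hg r N) _).integrable _).const_mul _
  · have h1 := tendsto_integral_norm_list_sum
      (fun N : ℕ => gaussianPi (α × Fin N × Fin N) (1 / (N : ℝ≥0))) (splits a (u l))
      (f := fun r N x => normTrace x (plainWord A ++ starWord (r.2 ++ r.1)) -
          (if A = r.2 ++ r.1 then 1 else 0)) (fun r N => (hg r N).integrable _)
      (fun r _ => tendsto_integral_norm_normTrace_sub A (r.2 ++ r.1))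
    have h2 := h1.const_mul ‖starRingEnd ℂ (c l)‖
    simp_rw [← integral_const_mul, mul_zero, ← norm_mul] at h2
    exact h2

theorem norm_cexp_traceComb (s : ℝ) (x : α × n × n → ℂ) :
    ‖Complex.exp (s * traceComb u c x * Complex.I)‖ = 1 := by
  rw [← Complex.ofReal_mul, Complex.norm_exp_ofReal_mul_I]

theorem conj_cexp_traceComb (s : ℝ) (x : α × n × n → ℂ) :
    starRingEnd ℂ (Complex.exp (s * traceComb u c x * Complex.I)) =
      Complex.exp ((-s : ℝ) * traceComb u c x * Complex.I) := by
  rw [← Complex.exp_conj]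
  simp

/-- The characteristic function of `traceComb`. -/
noncomputable def traceCharFun (n : Type*) [Fintype n] [DecidableEq n] (s : ℝ) : ℂ :=
  ∫ x, Complex.exp (s * traceComb u c x * Complex.I)
    ∂(gaussianPi (α × n × n) (1 / (Fintype.card n : ℝ≥0)))

/-- The exponential has modulus one, so replacing the kernel by its limit costs at most their `L¹`
distance. -/
theorem norm_integral_trace_sub_le (a : α) (A : List α) (s : ℝ) :
    ‖∫ x, (wordEval x (plainWord (a :: A))).trace *
        Complex.exp (s * traceComb u c x * Complex.I)
          ∂(gaussianPi (α × n × n) (1 / (Fintype.card n : ℝ≥0))) -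
      s * Complex.I / 2 * (traceKernelLimit u c a A * traceCharFun u c n s)‖ ≤
    |s| * ∫ x : α × n × n → ℂ, ‖traceKernel u c a A x - traceKernelLimit u c a A‖
        ∂(gaussianPi (α × n × n) (1 / (Fintype.card n : ℝ≥0))) := by
  have hE := hasTemperateGrowth_cexp (hasTemperateGrowth_traceComb (n := n) u c) s
  have hK := hasTemperateGrowth_traceKernel (n := n) u c a A
  rw [integral_trace_mul_cexp, traceCharFun, ← integral_const_mul (traceKernelLimit u c a A),
    ← mul_sub,
    ← integral_sub ((hK.fun_mul hE).integrable _) ((hE.integrable _).const_mul _), norm_mul]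
  have h1 : ‖(s * Complex.I / 2 : ℂ)‖ ≤ |s| := by
    simp only [norm_div, norm_mul, Complex.norm_real, Complex.norm_I, mul_one, Real.norm_eq_abs,
      Complex.norm_ofNat]
    linarith [abs_nonneg s]
  refine mul_le_mul h1 ?_ (norm_nonneg _) (abs_nonneg s)
  refine (norm_integral_le_integral_norm _).trans (le_of_eq ?_)
  congr 1
  funext x
  rw [← sub_mul, norm_mul, norm_cexp_traceComb, mul_one]

/-- The adjoint-word terms are written as conjugates of plain-word terms at `-s`, so that the
estimate for plain words alone suffices. -/
theorem hasDerivAt_traceCharFun (s : ℝ) :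
    HasDerivAt (traceCharFun u c n)
      (Complex.I * ∑ j, (c j / 2 * ∫ x, (wordEval x (plainWord (u j))).trace *
        Complex.exp (s * traceComb u c x * Complex.I)
          ∂(gaussianPi (α × n × n) (1 / (Fintype.card n : ℝ≥0))) +
        starRingEnd ℂ (c j / 2 * ∫ x, (wordEval x (plainWord (u j))).trace *
          Complex.exp ((-s : ℝ) * traceComb u c x * Complex.I)
          ∂(gaussianPi (α × n × n) (1 / (Fintype.card n : ℝ≥0)))))) s := by
  refine (hasDerivAt_integral_cexp ((hasTemperateGrowth_traceComb u c).integrable _) s).congr_deriv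
    ?_
  have hE := hasTemperateGrowth_cexp (hasTemperateGrowth_traceComb (n := n) u c) s
  have hi : ∀ W : List (α × Bool), Integrable (fun x : α × n × n → ℂ => (wordEval x W).trace *
      Complex.exp (s * traceComb u c x * Complex.I))
        (gaussianPi (α × n × n) (1 / (Fintype.card n : ℝ≥0))) := fun W =>
    ((hasTemperateGrowth_trace W).fun_mul hE).integrable _
  have h1 : ∀ x : α × n × n → ℂ, traceComb u c x * Complex.I *
      Complex.exp (s * traceComb u c x * Complex.I) =
      Complex.I * ∑ j, (c j / 2 * ((wordEval x (plainWord (u j))).trace *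
        Complex.exp (s * traceComb u c x * Complex.I)) +
        starRingEnd ℂ (c j) / 2 * ((wordEval x (starWord (u j))).trace *
          Complex.exp (s * traceComb u c x * Complex.I))) := by
    intro x
    rw [mul_comm _ Complex.I, mul_assoc]
    conv_lhs => rw [traceComb_eq u c x]
    rw [Finset.sum_mul]
    congr 1
    refine Finset.sum_congr rfl fun j _ => ?_
    rw [← traceComb_eq u c x]
    ring
  have hadd : ∀ j, Integrable (fun x : α × n × n → ℂ => c j / 2 *
      ((wordEval x (plainWord (u j))).trace *
        Complex.exp (s * traceComb u c x * Complex.I)) +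
        starRingEnd ℂ (c j) / 2 * ((wordEval x (starWord (u j))).trace *
          Complex.exp (s * traceComb u c x * Complex.I)))
        (gaussianPi (α × n × n) (1 / (Fintype.card n : ℝ≥0))) := fun j =>
    ((hi _).const_mul _).add ((hi _).const_mul _)
  simp_rw [h1]
  rw [integral_const_mul, integral_finsetSum _ fun j _ => hadd j]
  congr 1
  refine Finset.sum_congr rfl fun j _ => ?_
  rw [integral_add ((hi _).const_mul _) ((hi _).const_mul _), integral_const_mul,
    integral_const_mul, map_mul, ← integral_conj]
  congr 2
  · rw [map_div₀, map_ofNat]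
  · congr 1
    funext x
    rw [map_mul, star_trace_plainWord, conj_cexp_traceComb, neg_neg]

theorem traceCharFun_neg (s : ℝ) :
    traceCharFun u c n (-s) = starRingEnd ℂ (traceCharFun u c n s) := by
  rw [traceCharFun, traceCharFun, ← integral_conj]
  simp_rw [conj_cexp_traceComb]

/-- Hypothesis `hlim` says that the limiting covariance is diagonal with entries `K j`, which closes
the equation for the characteristic function with an error governed by the kernels' `L¹` distances
to their limits. -/
theorem tendsto_traceCharFun (a : κ → α) (A : κ → List α) (hu : ∀ j, u j = a j :: A j)
    (K : κ → ℝ) (hK : ∀ j, 0 ≤ K j)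
    (hlim : ∀ j, traceKernelLimit u c (a j) (A j) = starRingEnd ℂ (c j) * K j) :
    Tendsto (fun N : ℕ => traceCharFun u c (Fin N) 1) atTop
      (𝓝 (Complex.exp (-(∑ j, ‖c j‖ ^ 2 * K j : ℝ) / 4))) := by
  set κ₀ : ℝ := ∑ j, ‖c j‖ ^ 2 * K j with hκ₀
  have hκ : 0 ≤ κ₀ := Finset.sum_nonneg fun j _ => mul_nonneg (sq_nonneg _) (hK j)
  set ε : κ → ℕ → ℝ := fun j N => ∫ x : α × Fin N × Fin N → ℂ,
      ‖traceKernel u c (a j) (A j) x - traceKernelLimit u c (a j) (A j)‖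
        ∂(gaussianPi (α × Fin N × Fin N) (1 / (N : ℝ≥0))) with hε
  have hε0 : ∀ j N, 0 ≤ ε j N := fun j N => integral_nonneg fun x => norm_nonneg _
  have hbound : ∀ N : ℕ, ‖traceCharFun u c (Fin N) 1 * Real.exp (κ₀ / 4) - 1‖ ≤
      (∑ j, ‖c j‖ * ε j N) * Real.exp (κ₀ / 4) := by
    intro N
    refine norm_mul_cexp_sub_one_le (hasDerivAt_traceCharFun u c (n := Fin N)) (by
      simp [traceCharFun]) hκ (Finset.sum_nonneg fun j _ => mul_nonneg (norm_nonneg _) (hε0 j N)) ?_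
    intro s
    set J : κ → ℝ → ℂ := fun j s => ∫ x, (wordEval x (plainWord (u j))).trace *
        Complex.exp (s * traceComb u c x * Complex.I)
          ∂(gaussianPi (α × Fin N × Fin N) (1 / (Fintype.card (Fin N) : ℝ≥0))) with hJ
    have hJb : ∀ j s, ‖J j s - s * Complex.I / 2 * (starRingEnd ℂ (c j) * K j *
        traceCharFun u c (Fin N) s)‖ ≤ |s| * ε j N := by
      intro j s
      have := norm_integral_trace_sub_le (n := Fin N) u c (a j) (A j) s
      rw [hlim j, ← hu j] at this
      simpa only [hJ, hε, Fintype.card_fin, hlim j] using this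
    -- The main terms of the two conjugate halves each contribute `-s |c j|² K j / 4` times the
    -- characteristic function; together they cancel the added `s κ₀ / 2` term.
    have hsum : Complex.I * ∑ j, (c j / 2 * J j s + starRingEnd ℂ (c j / 2 * J j (-s))) +
        (s * κ₀ / 2 : ℝ) * traceCharFun u c (Fin N) s =
        Complex.I * ∑ j, (c j / 2 * (J j s - s * Complex.I / 2 * (starRingEnd ℂ (c j) * K j *
          traceCharFun u c (Fin N) s)) + starRingEnd ℂ (c j / 2 * (J j (-s) -
            (-s : ℝ) * Complex.I / 2 * (starRingEnd ℂ (c j) * K j *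
          traceCharFun u c (Fin N) (-s))))) := by
      have hk : ((s * κ₀ / 2 : ℝ) : ℂ) * traceCharFun u c (Fin N) s = Complex.I *
          ∑ j, -(s * Complex.I / 2 * (c j * starRingEnd ℂ (c j) * K j *
          traceCharFun u c (Fin N) s)) := by
        rw [hκ₀, Finset.mul_sum, Finset.sum_div, Complex.ofReal_sum, Finset.sum_mul,
          Finset.mul_sum]
        refine Finset.sum_congr rfl fun j _ => ?_
        rw [Complex.mul_conj']
        push_cast
        linear_combination ((s : ℂ) / 2 * ‖c j‖ ^ 2 * K j * traceCharFun u c (Fin N) s) *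
          Complex.I_sq
      rw [hk, ← mul_add, ← Finset.sum_add_distrib]
      congr 1
      refine Finset.sum_congr rfl fun j _ => ?_
      rw [traceCharFun_neg]
      simp only [map_mul, map_sub, map_div₀, Complex.conj_conj, Complex.conj_I,
        Complex.conj_ofReal, map_ofNat]
      push_cast
      ring
    have hterm : ∀ j, ‖c j / 2 * (J j s - s * Complex.I / 2 * (starRingEnd ℂ (c j) * K j *
          traceCharFun u c (Fin N) s)) + starRingEnd ℂ (c j / 2 * (J j (-s) -
            (-s : ℝ) * Complex.I / 2 * (starRingEnd ℂ (c j) * K j *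
          traceCharFun u c (Fin N) (-s))))‖ ≤ |s| * (‖c j‖ * ε j N) := by
      intro j
      refine (norm_add_le _ _).trans ?_
      rw [RCLike.norm_conj, norm_mul, norm_mul, norm_div, Complex.norm_ofNat]
      have h1 := mul_le_mul_of_nonneg_left (hJb j s) (by positivity : 0 ≤ ‖c j‖ / 2)
      have h2 := mul_le_mul_of_nonneg_left (hJb j (-s)) (by positivity : 0 ≤ ‖c j‖ / 2)
      rw [abs_neg] at h2
      linarith
    change ‖Complex.I * ∑ j, (c j / 2 * J j s + starRingEnd ℂ (c j / 2 * J j (-s))) +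
        (s * κ₀ / 2 : ℝ) * traceCharFun u c (Fin N) s‖ ≤ _
    rw [hsum, norm_mul, Complex.norm_I, one_mul, Finset.mul_sum]
    exact (norm_sum_le _ _).trans (Finset.sum_le_sum fun j _ => hterm j)
  have hto : Tendsto (fun N : ℕ => (∑ j, ‖c j‖ * ε j N) * Real.exp (κ₀ / 4)) atTop (𝓝 0) := by
    have h1 : Tendsto (fun N : ℕ => ∑ j, ‖c j‖ * ε j N) atTop (𝓝 (∑ j, ‖c j‖ * 0)) :=
      tendsto_finsetSum _ fun j _ =>
        (tendsto_integral_norm_traceKernel_sub u c (a j) (A j)).const_mul _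
    simpa using h1.mul_const (Real.exp (κ₀ / 4))
  have h1 := tendsto_iff_norm_sub_tendsto_zero.2
    (squeeze_zero (fun N => norm_nonneg _) hbound hto)
  have h2 := h1.mul_const (Complex.exp (-κ₀ / 4))
  rw [one_mul] at h2
  refine h2.congr fun N => ?_
  rw [mul_assoc, Complex.ofReal_exp, ← Complex.exp_add]
  push_cast
  rw [show (κ₀ / 4 + -κ₀ / 4 : ℂ) = 0 by ring, Complex.exp_zero, mul_one]

end LinearCombination

end CharFun

/-! ### Reduction to a finite alphabet, the Gaussian characteristic function, and assembly. -/

section Main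

open Topology

theorem map_wordPow {β γ : Type*} (f : β → γ) (u : List β) (k : ℕ) :
    (wordPow u k).map f = wordPow (u.map f) k := by
  simp [wordPow, List.map_flatten]

/-- Any positive root of the image is a prefix of it, hence itself an image. This permits passing to
the alphabet of letters occurring in `w`. -/
theorem coperiod_map_of_injective {β γ : Type*} {f : β → γ} (hf : Function.Injective f)
    (v : List β) : coperiod (v.map f) = coperiod v := by
  unfold coperiod
  congr 1
  ext k
  constructor
  · rintro ⟨u, hu⟩
    rcases k with _ | k
    · exact ⟨[], by simpa [wordPow] using hu⟩
    · have hpre : u <+: v.map f := by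
        rw [hu, wordPow_succ]
        exact List.prefix_append _ _
      have hu' : u = (v.take u.length).map f := by
        rw [List.map_take]
        exact (List.prefix_iff_eq_take.1 hpre)
      refine ⟨v.take u.length, ?_⟩
      apply List.map_injective_iff.2 hf
      rw [map_wordPow, ← hu', hu]
  · rintro ⟨u, rfl⟩
    exact ⟨u.map f, map_wordPow f u k⟩

theorem wordEval_plainWord_wordPow {α n : Type*} [Fintype α] [DecidableEq α] [Fintype n]
    [DecidableEq n] (x : α × n × n → ℂ) (v : List α) (k : ℕ) :
    wordEval x (plainWord (wordPow v k)) = wordEval x (plainWord v) ^ k := by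
  induction k with
  | zero => simp [wordPow, plainWord, wordEval]
  | succ k ih =>
    rw [wordPow_succ, pow_succ', ← ih, plainWord, List.map_append, wordEval_append]
    rfl

theorem wordEval_plainWord {α n : Type*} [Fintype α] [DecidableEq α] [Fintype n]
    [DecidableEq n] (M : α → Matrix n n ℂ) (v : List α) :
    wordEval (fun p : α × n × n => M p.1 p.2.1 p.2.2) (plainWord v) = (v.map M).prod := by
  rw [wordEval, plainWord, List.map_map]
  congr 1

theorem charFun_complexGaussian (v : ℝ≥0) (t : ℂ) :
    charFun (complexGaussian v) t = Complex.exp (-(‖t‖ ^ 2 * v : ℝ) / 4) := by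
  have hg : ∀ r : ℝ, ∫ p : ℝ, Complex.exp ((r * p : ℝ) * Complex.I) ∂(gaussianReal 0 (v / 2)) =
      Complex.exp (-(r ^ 2 * v : ℝ) / 4) := by
    intro r
    have h1 := charFun_gaussianReal (μ := 0) (v := v / 2) r
    rw [charFun_apply_real] at h1
    push_cast at h1 ⊢
    rw [h1]
    congr 1
    ring
  rw [charFun_apply, complexGaussian_eq_map, integral_map (by fun_prop)
    (by fun_prop : Continuous fun x : ℂ => Complex.exp (inner ℝ x t * Complex.I)).aestronglyMeasurable]
  have h2 : ∀ p : ℝ × ℝ, Complex.exp (inner ℝ (complexOfProd p) t * Complex.I) =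
      Complex.exp ((t.re * p.1 : ℝ) * Complex.I) * Complex.exp ((t.im * p.2 : ℝ) * Complex.I) := by
    intro p
    rw [← Complex.exp_add, complexOfProd_apply]
    congr 1
    rw [Complex.inner, ← add_mul, ← Complex.ofReal_add]
    congr 2
    simp
  simp_rw [h2]
  rw [integral_prod_mul (fun p : ℝ => Complex.exp ((t.re * p : ℝ) * Complex.I))
    (fun q : ℝ => Complex.exp ((t.im * q : ℝ) * Complex.I)), hg, hg, ← Complex.exp_add]
  congr 1
  rw [← Complex.normSq_eq_norm_sq, Complex.normSq_apply]
  push_cast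
  ring

/-- Restricting to the letters of `w` leaves finitely many entries, so their joint law is a finite
product measure. -/
theorem IsIIDGinibre.map_entries {Ω : Type*} [MeasurableSpace Ω] {P : Measure Ω}
    [IsProbabilityMeasure P] {N : ℕ} {G : ℕ → Ω → Matrix (Fin N) (Fin N) ℂ}
    (hG : IsIIDGinibre P N G) (w : List ℕ) :
    AEMeasurable (fun ω (p : {r // r ∈ w} × Fin N × Fin N) => G p.1 ω p.2.1 p.2.2) P ∧
    P.map (fun ω (p : {r // r ∈ w} × Fin N × Fin N) => G p.1 ω p.2.1 p.2.2) =
      gaussianPi ({r // r ∈ w} × Fin N × Fin N) (1 / (N : ℝ≥0)) := by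
  have hm : ∀ p : {r // r ∈ w} × Fin N × Fin N,
      AEMeasurable (fun ω => G p.1 ω p.2.1 p.2.2) P := fun p =>
    (hG.hasLaw_entry p.1 p.2.1 p.2.2).aemeasurable
  refine ⟨aemeasurable_pi_lambda _ hm, ?_⟩
  have hinj : Function.Injective
      (fun p : {r // r ∈ w} × Fin N × Fin N => ((p.1 : ℕ), p.2.1, p.2.2)) := by
    rintro ⟨⟨r, hr⟩, a, b⟩ ⟨⟨r', hr'⟩, a', b'⟩ h
    simpa using h
  have hind := hG.iIndepFun_entry.precomp hinj
  rw [(iIndepFun_iff_map_fun_eq_pi_map hm).1 hind]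
  congr 1
  funext p
  exact (hG.hasLaw_entry p.1 p.2.1 p.2.2).map_eq

theorem traceKernelLimit_wordPow {α : Type*} [Fintype α] [DecidableEq α] {v : List α}
    (hv : v ≠ []) {k : ℕ} (c : Fin k → ℂ) (j : Fin k) {a : α} {A : List α}
    (hA : wordPow v ((j : ℕ) + 1) = a :: A) :
    traceKernelLimit (fun l : Fin k => wordPow v ((l : ℕ) + 1)) c a A =
      starRingEnd ℂ (c j) * ((((j : ℕ) + 1 : ℕ) * coperiod v : ℕ) : ℝ) := by
  rw [traceKernelLimit, Finset.sum_eq_single j]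
  · rw [sum_splits_wordPow hv (Nat.succ_pos _) hA]
    simp
  · intro l _ hl
    rw [sum_splits_wordPow hv (Nat.succ_pos _) hA, if_neg, mul_zero]
    intro h
    exact hl (Fin.ext (by omega))
  · simp

end Main

theorem mainTheorem3
    (w : List ℕ) (hw : w ≠ []) (k : ℕ) (hk : 0 < k)
    {Ω : ℕ → Type*} [∀ N, MeasurableSpace (Ω N)]
    (P : (N : ℕ) → Measure (Ω N)) [∀ N, IsProbabilityMeasure (P N)]
    (G : (N : ℕ) → ℕ → Ω N → Matrix (Fin N) (Fin N) ℂ)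
    (hG : ∀ N, 0 < N → IsIIDGinibre (P N) N (G N))
    {Ω' : Type*} [MeasurableSpace Ω'] (P' : Measure Ω') [IsProbabilityMeasure P']
    (Z : Fin k → Ω' → ℂ)
    (hZ_law : ∀ j : Fin k,
      HasLaw (Z j) (complexGaussian (((j : ℕ) + 1 : ℕ) * (coperiod w : ℝ≥0))) P')
    (hZ_indep : iIndepFun Z P') :
    TendstoInDistribution
      (fun (N : ℕ) (ω : Ω N) (j : Fin k) =>
        Matrix.trace (wordProd (fun r => G N r ω) w ^ ((j : ℕ) + 1)))
      atTop
      (fun (ω : Ω') (j : Fin k) => Z j ω)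
      P P' := by
  set v : List {r // r ∈ w} := w.attach with hv
  have hvw : v.map Subtype.val = w := List.attach_map_subtype_val w
  have hv0 : v ≠ [] := fun h => hw (by rw [← hvw, h, List.map_nil])
  have hcop : coperiod v = coperiod w := by
    rw [← coperiod_map_of_injective Subtype.val_injective v, hvw]
  set u : Fin k → List {r // r ∈ w} := fun j => wordPow v ((j : ℕ) + 1) with hu
  set x : (N : ℕ) → Ω N → {r // r ∈ w} × Fin N × Fin N → ℂ :=
    fun N ω p => G N p.1 ω p.2.1 p.2.2 with hx
  have htr : ∀ (N : ℕ) (ω : Ω N) (j : Fin k),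
      Matrix.trace (wordProd (fun r => G N r ω) w ^ ((j : ℕ) + 1)) =
        (wordEval (x N ω) (plainWord (u j))).trace := by
    intro N ω j
    rw [hu, wordEval_plainWord_wordPow]
    congr 2
    rw [hx, wordEval_plainWord (fun r : {r // r ∈ w} => G N r ω), wordProd]
    conv_lhs => rw [← hvw, List.map_map]
    rfl
  have hcont : ∀ N : ℕ, Continuous fun (y : {r // r ∈ w} × Fin N × Fin N → ℂ) =>
      WithLp.toLp 2 (fun j : Fin k => (wordEval y (plainWord (u j))).trace) := fun N =>
    (PiLp.continuous_toLp 2 _).comp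
      (continuous_pi fun j => (hasTemperateGrowth_trace _).1.continuous)
  have hmeas : ∀ N : ℕ, AEMeasurable (fun ω : Ω N =>
      WithLp.toLp 2 (fun j : Fin k => (wordEval (x N ω) (plainWord (u j))).trace)) (P N) := by
    intro N
    rcases Nat.eq_zero_or_pos N with rfl | hN
    -- Nothing is assumed about the matrices for `N = 0`, but then there are no entries and the map
    -- is constant.
    · have : ∀ ω : Ω 0, x 0 ω = 0 := fun ω => funext fun p => p.2.1.elim0
      simp_rw [this]
      exact aemeasurable_const
    · exact (hcont N).measurable.comp_aemeasurable ((hG N hN).map_entries w).1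
  have hZm : ∀ j, AEMeasurable (Z j) P' := fun j => (hZ_law j).aemeasurable
  have hZm' : AEMeasurable (fun ω => WithLp.toLp 2 (fun j : Fin k => Z j ω)) P' :=
    (PiLp.continuous_toLp 2 _).measurable.comp_aemeasurable (aemeasurable_pi_lambda _ hZm)
  -- Convergence is proved in the Euclidean structure, where characteristic functions are available,
  -- and transported back by the continuous map `ofLp`.
  have hmain : TendstoInDistribution (fun (N : ℕ) (ω : Ω N) =>
      WithLp.toLp 2 (fun j : Fin k => (wordEval (x N ω) (plainWord (u j))).trace)) atTop
      (fun ω => WithLp.toLp 2 (fun j : Fin k => Z j ω)) P P' := by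
    refine ⟨hmeas, hZm', ?_⟩
    refine (ProbabilityMeasure.tendsto_iff_tendsto_charFun
      (E := PiLp 2 (fun _ : Fin k => ℂ))).2 fun t => ?_
    simp only [ProbabilityMeasure.coe_mk]
    -- The real inner product of `z` and `t` in `ℂ` is the real part of `z` times the conjugate of
    -- `t`.
    set c : Fin k → ℂ := fun j => starRingEnd ℂ (t j) with hc
    have hlim : charFun (P'.map fun ω => WithLp.toLp 2 (fun j : Fin k => Z j ω)) t =
        Complex.exp (-(∑ j : Fin k, ‖c j‖ ^ 2 *
          ((((j : ℕ) + 1 : ℕ) * coperiod v : ℕ) : ℝ) : ℝ) / 4) := by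
      rw [(iIndepFun_iff_charFun_pi hZm).1 hZ_indep t, Complex.ofReal_sum,
        ← Finset.sum_neg_distrib, Finset.sum_div, Complex.exp_sum]
      refine Finset.prod_congr rfl fun j _ => ?_
      rw [(hZ_law j).map_eq, charFun_complexGaussian, hcop, hc]
      simp
    rw [hlim]
    have hpos : ∀ j, ∃ a A, u j = a :: A := by
      intro j
      have : u j ≠ [] := by
        rw [hu]
        simp [wordPow_succ, hv0]
      exact List.exists_cons_of_ne_nil this
    choose a A hA using hpos
    refine (tendsto_traceCharFun u c a A hA
      (fun j => ((((j : ℕ) + 1 : ℕ) * coperiod v : ℕ) : ℝ)) (fun j => Nat.cast_nonneg _)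
      (fun j => traceKernelLimit_wordPow hv0 c j (hA j))).congr' ?_
    filter_upwards [eventually_gt_atTop 0] with N hN
    obtain ⟨hxm, hxlaw⟩ := (hG N hN).map_entries w
    rw [charFun_apply, integral_map (hmeas N) (by
      apply Continuous.aestronglyMeasurable
      fun_prop), traceCharFun, Fintype.card_fin, ← hxlaw, integral_map hxm
        (hasTemperateGrowth_cexp (hasTemperateGrowth_traceComb u c) 1).1.continuous.aestronglyMeasurable]
    congr 1
    funext ω
    congr 2
    rw [Complex.ofReal_one, one_mul, PiLp.inner_apply, traceComb]
    congr 1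
    refine Finset.sum_congr rfl fun j _ => ?_
    rw [Complex.inner, hc, ← Complex.conj_re]
    simp [hx]
  have := hmain.continuous_comp (PiLp.continuous_ofLp 2 (fun _ : Fin k => ℂ))
  simp_rw [htr]
  exact this
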